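/- A $\mathrm{CAT}(0)$ space is a complete geodesic metric space whose geodesic triangles are not thicker than their Euclidean comparison triangles. A bounded sequence $(x_n)$ in a $\mathrm{CAT}(0)$ space $X$ converges weakly to $x\in X$ if, for every compact geodesic $c$ starting at $x$, the closest-point projections of $x_n$ to $c$ converge to $x$. The weak topology $\mathcal T_\Delta$ on $X$ is the topology whose closed sets are the sets $A\subset X$ that contain the weak limit of every bounded weakly converging sequence of points of $A$. Let $Y$ be the metric tree with a centre $p$, edges $[p,b_i]$ ($i\in\mathbb N$), and edges $[b_i,e_{ij}]$ ($i,j\in\mathbb N$), all of length $\pi/4$ and with no other identifications. Let $\hat X$ be the Euclidean cone over $Y$ with tip $o$: its points are $\lambda\cdot y$ with $\lambda\ge 0$, $y\in Y$, where $0\cdot y=o$ for all $y$, and $$d(\lambda\cdot y,\mu\cdot z)^2=\lambda^2+\mu^2-2\lambda\mu\cos\bigl(\min(\pi,d_Y(y,z))\bigr).$$ For an edge $I=[y_1,y_2]$ of $Y$ let $S_I\subset\hat X$ be the triangle with vertices $o$, $2\cdot y_1$, $2\cdot y_2$, that is, the convex hull of these three points in the planar sector that is the cone over $I$. Let $X\subset\hat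 X$ be the union of all the triangles $S_I$, with the metric of $\hat X$. Then $X$ is a bounded, separable $\mathrm{CAT}(0)$ space. It is a two-dimensional Euclidean simplicial complex with its length metric, it has countably many simplices, and its $2$-simplices are precisely the triangles $S_I$. The points $o$ and $\frac12\cdot p$ of $X$ do not have disjoint $\mathcal T_\Delta$-open neighbourhoods; in particular, $\mathcal T_\Delta$ is not Hausdorff. Consequently, there exists a bounded, separable, two-dimensional $\mathrm{CAT}(0)$ simplicial complex whose weak topology $\mathcal T_\Delta$ is not Hausdorff. -/

import Mathlib

open scoped NNReal Topology

noncomputable section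

/-! ### Geodesics, CAT(0) spaces, weak convergence and the weak topology -/

/-- The metric segment between `x` and `y`. In a geodesic space this is the union of all geodesics
joining `x` to `y`. -/
def metricSegment {X : Type*} [MetricSpace X] (x y : X) : Set X :=
  {z | dist x z + dist z y = dist x y}

/-- `γ` restricted to `[0, L]` is a (compact, unit speed) geodesic. -/
def IsGeodesic {X : Type*} [MetricSpace X] (γ : ℝ → X) (L : ℝ) : Prop :=
  0 ≤ L ∧ ∀ s ∈ Set.Icc 0 L, ∀ t ∈ Set.Icc 0 L, dist (γ s) (γ t) = |s - t|

/-- A CAT(0) space: a complete geodesic metric space all of whose geodesic triangles are not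
thicker than their Euclidean comparison triangles. The points `x` and `y` lie on the sides `[p, q]`
and `[p, r]` of a triangle, and the primed points are the corresponding points of a comparison
triangle in the Euclidean plane. -/
structure IsCAT0 (X : Type*) [MetricSpace X] : Prop where
  complete : CompleteSpace X
  geodesic : ∀ x y : X, ∃ γ : ℝ → X, IsGeodesic γ (dist x y) ∧ γ 0 = x ∧ γ (dist x y) = y
  comparison : ∀ (p q r x y : X) (p' q' r' x' y' : EuclideanSpace ℝ (Fin 2)),
    dist p' q' = dist p q → dist p' r' = dist p r → dist q' r' = dist q r →
    x ∈ metricSegment p q → dist p' x' = dist p x → dist x' q' = dist x q →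
    y ∈ metricSegment p r → dist p' y' = dist p y → dist y' r' = dist y r →
    dist x y ≤ dist x' y'

/-- `q` is a closest point to `y` in `c`. -/
def IsClosestPoint {X : Type*} [MetricSpace X] (c : Set X) (y q : X) : Prop :=
  q ∈ c ∧ ∀ z ∈ c, dist y q ≤ dist y z

/-- Weak convergence of the bounded sequence `u` to `x`: for every compact geodesic starting
at `x`, the closest-point projections of `u n` to it converge to `x`. -/
def WeaklyConverges {X : Type*} [MetricSpace X] (u : ℕ → X) (x : X) : Prop :=
  Bornology.IsBounded (Set.range u) ∧
    ∀ (γ : ℝ → X) (L : ℝ), IsGeodesic γ L → γ 0 = x →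
      ∀ q : ℕ → X, (∀ n, IsClosestPoint (γ '' Set.Icc 0 L) (u n) (q n)) →
        Filter.Tendsto q Filter.atTop (𝓝 x)

/-- A set is weakly closed if it contains all weak limits of its bounded sequences. -/
def IsWeaklyClosed {X : Type*} [MetricSpace X] (A : Set X) : Prop :=
  ∀ (u : ℕ → X) (x : X), (∀ n, u n ∈ A) → WeaklyConverges u x → x ∈ A

theorem IsGeodesic.isCompact_image {X : Type*} [MetricSpace X] {γ : ℝ → X} {L : ℝ}
    (h : IsGeodesic γ L) : IsCompact (γ '' Set.Icc 0 L) := by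
  refine isCompact_Icc.image_of_continuousOn ?_
  refine LipschitzOnWith.continuousOn (K := 1) (LipschitzOnWith.of_dist_le_mul ?_)
  intro s hs t ht
  rw [h.2 s hs t ht]
  simp [Real.dist_eq]

theorem WeaklyConverges.comp {X : Type*} [MetricSpace X] {u : ℕ → X} {x : X}
    (h : WeaklyConverges u x) {φ : ℕ → ℕ} (hφ : StrictMono φ) : WeaklyConverges (u ∘ φ) x := by
  refine ⟨h.1.subset (Set.range_comp_subset_range φ u), fun γ L hγ h0 q hq => ?_⟩
  have hex : ∀ n, ∃ z, IsClosestPoint (γ '' Set.Icc 0 L) (u n) z := by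
    intro n
    obtain ⟨z, hz, hmin⟩ := hγ.isCompact_image.exists_isMinOn
      ⟨γ 0, 0, ⟨le_refl _, hγ.1⟩, rfl⟩ (f := fun z => dist (u n) z) (by fun_prop)
    exact ⟨z, hz, fun w hw => hmin hw⟩
  choose z hz using hex
  classical
  have key := h.2 γ L hγ h0
    (fun n => if hn : ∃ k, φ k = n then q hn.choose else z n) (fun n => by
      by_cases hn : ∃ k, φ k = n
      · simp only [hn, dif_pos]
        have := hq hn.choose
        simpa [hn.choose_spec] using this
      · simp only [hn, dif_neg, not_false_eq_true]
        exact hz n)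
  have := key.comp hφ.tendsto_atTop
  refine this.congr fun k => ?_
  have hk : ∃ k', φ k' = φ k := ⟨k, rfl⟩
  simp only [Function.comp, hk, dif_pos]
  rw [hφ.injective hk.choose_spec]

/-- The weak topology `T_Δ`: the topology whose closed sets are the weakly closed sets. -/
@[reducible] def weakTopology (X : Type*) [MetricSpace X] : TopologicalSpace X :=
  TopologicalSpace.ofClosed {A | IsWeaklyClosed A}
    (fun _ _ hu _ => (hu 0).elim)
    (fun _ hA u x hu hx B hB => hA hB u x (fun n => hu n B hB) hx)
    (fun A hA B hB u x hu hx => by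
      by_cases h : ∃ᶠ n in Filter.atTop, u n ∈ A
      · obtain ⟨φ, hφ, hφA⟩ := Filter.extraction_of_frequently_atTop h
        exact Or.inl (hA _ x hφA (hx.comp hφ))
      · rw [Filter.not_frequently] at h
        obtain ⟨φ, hφ, hφB⟩ := Filter.extraction_of_frequently_atTop
          (h.mono fun n hn => (hu n).resolve_left hn).frequently
        exact Or.inr (hB _ x hφB (hx.comp hφ)))

/-! ### Euclidean simplicial complexes -/

/-- The structure of a (Euclidean) simplicial complex on a set `X`: an abstract simplicial complex
`K`, an identification of `X` with the geometric realization of `K` through barycentric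
coordinates, and, for each simplex of `K`, a nondegenerate Euclidean simplex with the same vertices,
such that common vertices of two simplices have the same distance in both (so that simplices
are glued by isometries of faces). -/
structure EuclideanComplex (X : Type*) where
  V : Type
  K : AbstractSimplicialComplex V
  bary : X → V → ℝ
  bary_injective : Function.Injective bary
  range_bary : Set.range bary =
    {w | (∀ v, 0 ≤ w v) ∧ ∃ s ∈ K.faces, Function.support w = (s : Set V) ∧ ∑ v ∈ s, w v = 1}
  vertex : (s : Finset V) → s → EuclideanSpace ℝ s
  affineIndependent : ∀ s ∈ K.faces, AffineIndependent ℝ (vertex s)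
  dist_vertex : ∀ s ∈ K.faces, ∀ t ∈ K.faces,
    ∀ (v w : V) (hvs : v ∈ s) (hws : w ∈ s) (hvt : v ∈ t) (hwt : w ∈ t),
      dist (vertex s ⟨v, hvs⟩) (vertex s ⟨w, hws⟩) = dist (vertex t ⟨v, hvt⟩) (vertex t ⟨w, hwt⟩)

namespace EuclideanComplex

variable {X : Type*} (C : EuclideanComplex X)

/-- The closed simplex of `X` spanned by `s`. -/
def closedSimplex (s : Finset C.V) : Set X :=
  {x | Function.support (C.bary x) ⊆ (s : Set C.V)}

/-- The position, in the Euclidean simplex attached to `s`, of a point of the closed simplex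
spanned by `s`. -/
def position (s : Finset C.V) (x : X) : EuclideanSpace ℝ s :=
  ∑ v : s, C.bary x v • C.vertex s v

/-- The lengths of the strings from `x` to `y`: finite sequences of points such that any two
consecutive points lie in a common closed simplex, in which their distance is measured. -/
def stringLengths (x y : X) : Set ℝ :=
  {l | ∃ (n : ℕ) (z : ℕ → X) (s : ℕ → Finset C.V), z 0 = x ∧ z n = y ∧
    (∀ i < n, s i ∈ C.K.faces ∧ z i ∈ C.closedSimplex (s i) ∧ z (i + 1) ∈ C.closedSimplex (s i)) ∧
    l = ∑ i ∈ Finset.range n, dist (C.position (s i) (z i)) (C.position (s i) (z (i + 1)))}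

/-- The metric of `X` is the length metric of the complex. -/
def InducesMetric [MetricSpace X] : Prop :=
  ∀ x y : X, IsGLB (C.stringLengths x y) (dist x y)

/-- The complex has dimension `n`. -/
def HasDimension (n : ℕ) : Prop :=
  (∀ s ∈ C.K.faces, s.card ≤ n + 1) ∧ ∃ s ∈ C.K.faces, s.card = n + 1

end EuclideanComplex

/-! ### Euclidean cones -/

/-- The distance `√(a² + b² - 2 a b cos θ)` of the endpoints of two planar segments of lengths
`a` and `b` that make the angle `θ` at their common initial point. -/
def coneDist (a b θ : ℝ) : ℝ := √(a ^ 2 + b ^ 2 - 2 * a * b * Real.cos θ)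

theorem coneDist_eq_norm (a b α β : ℝ) :
    coneDist a b (α - β) =
      ‖(a : ℂ) * Complex.exp (α * Complex.I) - b * Complex.exp (β * Complex.I)‖ := by
  rw [Complex.norm_eq_sqrt_sq_add_sq, coneDist]
  congr 1
  simp only [Complex.sub_re, Complex.sub_im, Complex.re_ofReal_mul, Complex.im_ofReal_mul,
    Complex.exp_ofReal_mul_I_re, Complex.exp_ofReal_mul_I_im]
  rw [Real.cos_sub]
  linear_combination -a ^ 2 * Real.sin_sq_add_cos_sq α - b ^ 2 * Real.sin_sq_add_cos_sq β

theorem coneDist_mono {a b θ θ' : ℝ} (ha : 0 ≤ a) (hb : 0 ≤ b) (h0 : 0 ≤ θ) (h : θ ≤ θ')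
    (hπ : θ' ≤ Real.pi) : coneDist a b θ ≤ coneDist a b θ' := by
  unfold coneDist
  apply Real.sqrt_le_sqrt
  have := Real.cos_le_cos_of_nonneg_of_le_pi h0 hπ h
  nlinarith [mul_le_mul_of_nonneg_left this (mul_nonneg ha hb)]

theorem coneDist_triangle (a b c θ φ : ℝ) :
    coneDist a c (θ + φ) ≤ coneDist a b θ + coneDist b c φ := by
  have h1 := coneDist_eq_norm a c θ (-φ)
  have h2 := coneDist_eq_norm a b θ 0
  have h3 := coneDist_eq_norm b c 0 (-φ)
  simp only [sub_neg_eq_add, sub_zero, zero_add] at h1 h2 h3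
  rw [h1, h2, h3]
  exact norm_sub_le_norm_sub_add_norm_sub _ _ _

/-- Polar coordinates on the Euclidean cone over `Y`. -/
structure ConeCoord (Y : Type*) where
  radius : ℝ≥0
  direction : Y

/-- The Euclidean cone metric, in polar coordinates. -/
instance ConeCoord.instPseudoMetricSpace (Y : Type*) [MetricSpace Y] :
    PseudoMetricSpace (ConeCoord Y) where
  dist x y := coneDist x.radius y.radius (min Real.pi (dist x.direction y.direction))
  dist_self x := by
    simp [coneDist, Real.pi_pos.le]
    ring_nf
    simp
  dist_comm x y := by
    simp only [coneDist, dist_comm x.direction y.direction]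
    ring_nf
  dist_triangle x y z := by
    have hπ := Real.pi_pos
    set θ := min Real.pi (dist x.direction y.direction) with hθ
    set φ := min Real.pi (dist y.direction z.direction) with hφ
    set ψ := min Real.pi (dist x.direction z.direction) with hψ
    have hθ0 : 0 ≤ θ := le_min hπ.le dist_nonneg
    have hφ0 : 0 ≤ φ := le_min hπ.le dist_nonneg
    have hψ0 : 0 ≤ ψ := le_min hπ.le dist_nonneg
    have hθπ : θ ≤ Real.pi := min_le_left _ _
    have hφπ : φ ≤ Real.pi := min_le_left _ _
    have hψπ : ψ ≤ Real.pi := min_le_left _ _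
    have hx := x.radius.coe_nonneg
    have hy := y.radius.coe_nonneg
    have hz := z.radius.coe_nonneg
    rcases le_total (θ + φ) Real.pi with h | h
    · have hle : ψ ≤ θ + φ := by
        have htri := dist_triangle x.direction y.direction z.direction
        have h1 : ψ ≤ dist x.direction z.direction := min_le_right _ _
        rcases min_choice Real.pi (dist x.direction y.direction) with h2 | h2 <;>
        rcases min_choice Real.pi (dist y.direction z.direction) with h3 | h3 <;>
        rw [← hθ] at h2 <;> rw [← hφ] at h3 <;> linarith
      exact (coneDist_mono hx hz hψ0 hle h).trans (coneDist_triangle _ _ _ _ _)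
    · have h1 := coneDist_mono hx hz hψ0 hψπ le_rfl
      have h2 := coneDist_triangle x.radius y.radius z.radius θ (Real.pi - θ)
      have h3 := coneDist_mono hy hz (by linarith : 0 ≤ Real.pi - θ) (by linarith) hφπ
      rw [add_sub_cancel] at h2
      linarith

/-- The Euclidean cone over the (nonempty) metric space `Y`. -/
abbrev EuclideanCone (Y : Type*) [MetricSpace Y] : Type _ := SeparationQuotient (ConeCoord Y)

/-- The point `r · y` of the cone, at distance `r` from the tip in the direction `y`. -/
def EuclideanCone.point {Y : Type*} [MetricSpace Y] (r : ℝ≥0) (y : Y) : EuclideanCone Y :=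
  SeparationQuotient.mk ⟨r, y⟩

/-! ### The tree -/

/-- Coordinates on the tree `Y`, which has a centre `p`, countably many edges `[p, b i]` at `p`
and, at each `b i`, countably many further edges `[b i, e i j]`; all edges have length `π / 4`.
The coordinates `(i, j, t)` stand for the point at distance `t` from `p` on the path from `p` through
`b i` to `e i j`, which has length `π / 2`. -/
structure TreeCoord where
  i : ℕ
  j : ℕ
  t : Set.Icc (0 : ℝ) (Real.pi / 2)

namespace TreeCoord

/-- The length of the common initial part of the paths from `p` to `e i j` and to `e i' j'`. -/
def overlap (x y : TreeCoord) : ℝ :=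
  if x.i = y.i then (if x.j = y.j then Real.pi / 2 else Real.pi / 4) else 0

/-- The distance from `p` of the point at which the paths from `p` to `x` and to `y` separate. -/
def meet (x y : TreeCoord) : ℝ := min (min (x.t : ℝ) y.t) (overlap x y)

theorem overlap_comm (x y : TreeCoord) : overlap x y = overlap y x := by
  simp only [overlap, eq_comm]

theorem overlap_ultra (x y z : TreeCoord) : min (overlap x y) (overlap y z) ≤ overlap x z := by
  have := Real.pi_pos
  unfold overlap
  split_ifs <;> first | (exfalso; omega) | (simp; try linarith)

/-- The path metric of the tree. -/
instance instPseudoMetricSpace : PseudoMetricSpace TreeCoord where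
  dist x y := x.t + y.t - 2 * meet x y
  dist_self x := by
    have : meet x x = x.t := by simpa [meet, overlap] using x.t.2.2
    rw [this]; ring
  dist_comm x y := by
    simp only [meet, overlap_comm x y, min_comm (x.t : ℝ) y.t]
    ring
  dist_triangle x y z := by
    have h := overlap_ultra x y z
    have key : min (meet x y) (meet y z) ≤ meet x z := by
      simp only [meet, le_min_iff]
      refine ⟨⟨?_, ?_⟩, le_trans (le_min ?_ ?_) h⟩ <;> simp
    have h1 : meet x y ≤ y.t := (min_le_left _ _).trans (min_le_right _ _)
    have h2 : meet y z ≤ y.t := (min_le_left _ _).trans (min_le_left _ _)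
    rcases min_choice (meet x y) (meet y z) with h3 | h3 <;> rw [h3] at key <;> linarith

end TreeCoord

/-- The metric tree `Y`. -/
abbrev ConeTree : Type := SeparationQuotient TreeCoord

/-- The centre `p` of the tree. -/
def ConeTree.p : ConeTree :=
  SeparationQuotient.mk ⟨0, 0, ⟨0, le_rfl, by positivity⟩⟩

/-- The edges of the tree: `inner i` is `[p, b i]` and `outer i j` is `[b i, e i j]`. -/
inductive TreeEdge where
  | inner (i : ℕ)
  | outer (i j : ℕ)

/-- The parametrization of an edge by arc length. -/
def TreeEdge.param : TreeEdge → Set.Icc (0 : ℝ) (Real.pi / 4) → ConeTree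
  | inner i, t => SeparationQuotient.mk
      ⟨i, 0, ⟨t, t.2.1, by linarith [t.2.2, Real.pi_pos]⟩⟩
  | outer i j, t => SeparationQuotient.mk
      ⟨i, j, ⟨Real.pi / 4 + t, by linarith [t.2.1, Real.pi_pos], by linarith [t.2.2]⟩⟩

/-! ### The complex -/

/-- The planar triangle with the vertices `0`, `2`, `2 exp (i π / 4)`. -/
def modelTriangle : Set ℂ :=
  convexHull ℝ {0, 2, 2 * Complex.exp ((Real.pi / 4 : ℝ) * Complex.I)}

/-- The triangle in the cone over the tree with the vertices `o`, `2 · y₁`, `2 · y₂`, where `y₁` and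
`y₂` are the endpoints of the edge `e`. The cone over `e` is a planar sector of angle `π / 4`; the
triangle is the convex hull of the three points in this sector. -/
def coneTriangle (e : TreeEdge) : Set (EuclideanCone ConeTree) :=
  {x | ∃ (r : ℝ≥0) (t : Set.Icc (0 : ℝ) (Real.pi / 4)),
    (r : ℂ) * Complex.exp ((t : ℝ) * Complex.I) ∈ modelTriangle ∧
      x = EuclideanCone.point r (e.param t)}

/-- The truncated cone `X`: the union of the triangles over all edges of the tree, with the metric
of the cone. -/
abbrev TruncatedCone : Type := {x : EuclideanCone ConeTree // ∃ e, x ∈ coneTriangle e}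

theorem point_p_mem (r : ℝ≥0) (hr : r ≤ 2) :
    ∃ e, EuclideanCone.point r ConeTree.p ∈ coneTriangle e := by
  refine ⟨TreeEdge.inner 0, r, ⟨0, le_rfl, by positivity⟩, ?_, rfl⟩
  have h0 : (0 : ℂ) ∈ modelTriangle := subset_convexHull ℝ _ (by simp)
  have h2 : (2 : ℂ) ∈ modelTriangle := subset_convexHull ℝ _ (by simp)
  have hr' : (r : ℝ) ≤ 2 := by exact_mod_cast hr
  have := (convex_convexHull ℝ _) h0 h2 (a := 1 - r / 2) (b := r / 2)
    (by linarith) (by positivity) (by ring)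
  have h : (r : ℂ) * Complex.exp (((0 : ℝ) : ℂ) * Complex.I) =
      (1 - (r : ℝ) / 2) • (0 : ℂ) + ((r : ℝ) / 2) • (2 : ℂ) := by
    simp
  exact h ▸ this

namespace TruncatedCone

/-- The tip `o` of the cone. -/
def o : TruncatedCone := ⟨EuclideanCone.point 0 ConeTree.p, point_p_mem 0 (by norm_num)⟩

/-- The point `p / 2`. -/
def halfP : TruncatedCone :=
  ⟨EuclideanCone.point (1 / 2) ConeTree.p, point_p_mem (1 / 2) (by
    rw [← NNReal.coe_le_coe]; norm_num)⟩

/-- The triangle over the edge `e` as a subset of the truncated cone. -/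
def triangle (e : TreeEdge) : Set TruncatedCone := {x | x.1 ∈ coneTriangle e}

end TruncatedCone

end

/-! CAT(0). Stewart's inequality at every point of a segment (`IsStewartPoint`) yields geodesics and
the comparison of triangles. On the cone over the tree it is checked by unfolding. The sector over
the path from `d` to `c` is planar. By the four-point condition of trees, any direction `v` can be
replaced by an angle χ on that path's line, so that distances to the two ends do not grow and the
distance to the intermediate direction does not shrink; the planar identity then gives the
inequality (`dist_treePoint_sq_le`). All tree distances are at most π, so the cut-off in the cone
metric never acts. The truncation is convex because, folded onto a quadrant by (r cos t, r sin t),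
it is cut out by two linear inequalities that survive along segments
(`exists_mem_coneTriangle_of_polar`).

Not Hausdorff. In a cone, the foot of the perpendicular from l·y to the ray over v at angle ω is (l
cos ω)·v, and any point whose direction is reached from y through v is seen from the foot under an
angle of at least π/2 with l·y. If this holds eventually for every test point, the sequence
converges weakly to the foot. Three right-angled projections result: (√2/2)·b_i → ½·p as i → ∞;
1·e_ij → (√2/2)·b_i as j → ∞; and 1·e_{i f(i)} → o for every f, because cos(π/2) = 0. A weakly open
V around ½·p contains (√2/2)·b_i for all large i, hence for each of these some 1·e_{i f(i)}; a
weakly open U around o contains almost all of these points as well. So U meets V.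

Complex. Barycentric coordinates come from the folded planar coordinates. Each triangle is isometric
to one with vertices on orthogonal axes, so squared distances are weighted sums of squares. A
geodesic lies over the branches of its two ends, hence in at most four triangles, and can be cut
into a string of its own length. -/

noncomputable section

/-! ### A criterion for CAT(0) spaces -/

/-- Stewart's identity in an inner product space. -/
theorem dist_sq_lineMap {E : Type*} [NormedAddCommGroup E] [InnerProductSpace ℝ E]
    (p q r : E) (t : ℝ) :
    dist p (AffineMap.lineMap q r t) ^ 2 =
      (1 - t) * dist p q ^ 2 + t * dist p r ^ 2 - t * (1 - t) * dist q r ^ 2 := by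
  have h1 : p - AffineMap.lineMap q r t = (1 - t) • (p - q) + t • (p - r) := by
    rw [AffineMap.lineMap_apply_module]; module
  have h2 : q - r = (p - r) - (p - q) := by abel
  rw [dist_eq_norm, dist_eq_norm, dist_eq_norm, dist_eq_norm, h1, h2, norm_add_sq_real,
    norm_sub_sq_real (p - r), norm_smul, norm_smul, inner_smul_left, inner_smul_right, mul_pow, mul_pow,
    Real.norm_eq_abs, Real.norm_eq_abs, sq_abs, sq_abs, real_inner_comm (p - q) (p - r)]
  simp
  ring

/-- `m` satisfies Stewart's inequality for the point dividing `[q, r]` in the ratio `t : 1 - t`. -/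
def IsStewartPoint {X : Type*} [MetricSpace X] (q r : X) (t : ℝ) (m : X) : Prop :=
  ∀ p, dist p m ^ 2 ≤
    (1 - t) * dist p q ^ 2 + t * dist p r ^ 2 - t * (1 - t) * dist q r ^ 2

namespace IsStewartPoint

variable {X : Type*} [MetricSpace X] {q r m m' : X} {t t' : ℝ}

theorem dist_left (h : IsStewartPoint q r t m) (ht : t ∈ Set.Icc (0 : ℝ) 1) :
    dist q m = t * dist q r := by
  have hq := h q
  have hr := h r
  rw [dist_self] at hq
  rw [dist_self, dist_comm r q, dist_comm r m] at hr
  have h1 : dist q m ≤ t * dist q r :=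
    abs_le_of_sq_le_sq' (by nlinarith) (mul_nonneg ht.1 dist_nonneg) |>.2
  have h2 : dist m r ≤ (1 - t) * dist q r :=
    abs_le_of_sq_le_sq' (by nlinarith) (mul_nonneg (by linarith [ht.2]) dist_nonneg) |>.2
  linarith [dist_triangle q m r]

theorem dist_right (h : IsStewartPoint q r t m) (ht : t ∈ Set.Icc (0 : ℝ) 1) :
    dist m r = (1 - t) * dist q r := by
  have hr := h r
  rw [dist_self, dist_comm r q, dist_comm r m] at hr
  have h2 : dist m r ≤ (1 - t) * dist q r :=
    abs_le_of_sq_le_sq' (by nlinarith) (mul_nonneg (by linarith [ht.2]) dist_nonneg) |>.2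
  linarith [dist_triangle q m r, h.dist_left ht]

/-- Stewart's inequality for `m'` tested at `m`, whose distances to the ends are known, collapses to
(t - t')² times the squared length. The reverse bound is the triangle inequality from `q`. -/
theorem dist_eq (h : IsStewartPoint q r t m) (h' : IsStewartPoint q r t' m')
    (ht : t ∈ Set.Icc (0 : ℝ) 1) (ht' : t' ∈ Set.Icc (0 : ℝ) 1) :
    dist m m' = |t - t'| * dist q r := by
  have hl := h.dist_left ht
  have hr := h.dist_right ht
  have hl' := h'.dist_left ht'
  have hm := h' m
  rw [dist_comm m q, hl, hr] at hm
  have h1 : dist m m' ≤ |t - t'| * dist q r := by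
    refine abs_le_of_sq_le_sq' ?_ (by positivity) |>.2
    rw [mul_pow, sq_abs]
    nlinarith
  have h2 := abs_dist_sub_le m m' q
  rw [dist_comm m q, dist_comm m' q, hl, hl', ← sub_mul, abs_mul, abs_of_nonneg dist_nonneg] at h2
  linarith

/-- A Stewart point is the only point of the metric segment at its distance from the ends. -/
theorem eq_of_dist (h : IsStewartPoint q r t m) (hl : dist q m' = t * dist q r)
    (hr : dist m' r = (1 - t) * dist q r) : m' = m := by
  have hm := h m'
  rw [dist_comm m' q, hl, hr] at hm
  have : dist m' m ^ 2 ≤ 0 := by nlinarith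
  exact dist_le_zero.1 (by nlinarith [dist_nonneg (x := m') (y := m)])

end IsStewartPoint

/-- A point of a metric segment is a Stewart point if the segment has Stewart points. -/
theorem exists_isStewartPoint_of_mem_metricSegment {X : Type*} [MetricSpace X]
    (h : ∀ (q r : X), ∀ t ∈ Set.Icc (0 : ℝ) 1, ∃ m, IsStewartPoint q r t m)
    {q r x : X} (hx : x ∈ metricSegment q r) :
    ∃ t ∈ Set.Icc (0 : ℝ) 1, IsStewartPoint q r t x ∧ dist q x = t * dist q r ∧
      dist x r = (1 - t) * dist q r := by
  have hx' : dist q x + dist x r = dist q r := hx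
  rcases eq_or_ne q r with rfl | hne
  · have h0 : dist q x = 0 := by
      rw [dist_self, dist_comm x q] at hx'
      linarith [dist_nonneg (x := q) (y := x)]
    obtain rfl := dist_eq_zero.1 h0
    exact ⟨0, by simp, fun p => by simp, by simp, by simp⟩
  · have hD := dist_pos.2 hne
    have ht : dist q x / dist q r ∈ Set.Icc (0 : ℝ) 1 :=
      ⟨by positivity, (div_le_one hD).2 (by linarith [dist_nonneg (x := x) (y := r)])⟩
    obtain ⟨m, hm⟩ := h q r _ ht
    have h1 : dist q x = dist q x / dist q r * dist q r := by field_simp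
    have h2 : dist x r = (1 - dist q x / dist q r) * dist q r := by
      rw [sub_mul, ← h1]; linarith
    have := hm.eq_of_dist h1 h2
    exact ⟨_, ht, this ▸ hm, h1, h2⟩

theorem exists_isGeodesic_of_isStewartPoint {X : Type*} [MetricSpace X] {q r : X} {σ : ℝ → X}
    (hσ : ∀ t ∈ Set.Icc (0 : ℝ) 1, IsStewartPoint q r t (σ t)) :
    ∃ γ : ℝ → X, IsGeodesic γ (dist q r) ∧ γ 0 = q ∧ γ (dist q r) = r ∧
      ∀ s ∈ Set.Icc 0 (dist q r), ∃ t ∈ Set.Icc (0 : ℝ) 1, γ s = σ t := by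
  have h01 : (0 : ℝ) ∈ Set.Icc (0 : ℝ) 1 := by simp
  have h11 : (1 : ℝ) ∈ Set.Icc (0 : ℝ) 1 := by simp
  have e0 : σ 0 = q := ((hσ 0 h01).eq_of_dist (by simp) (by simp)).symm
  have e1 : σ 1 = r := ((hσ 1 h11).eq_of_dist (by simp) (by simp)).symm
  have hmem : ∀ s ∈ Set.Icc 0 (dist q r), s / dist q r ∈ Set.Icc (0 : ℝ) 1 := fun s hs =>
    ⟨div_nonneg hs.1 dist_nonneg, div_le_one_of_le₀ hs.2 dist_nonneg⟩
  refine ⟨fun s => σ (s / dist q r), ⟨dist_nonneg, fun s hs t ht => ?_⟩, by simp [e0], ?_,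
    fun s hs => ⟨_, hmem s hs, rfl⟩⟩
  · rw [(hσ _ (hmem s hs)).dist_eq (hσ _ (hmem t ht)) (hmem s hs) (hmem t ht), ← sub_div, abs_div,
      abs_of_nonneg dist_nonneg]
    rcases eq_or_ne (dist q r) 0 with h0 | h0
    · rw [h0] at hs ht
      have hs0 : s = 0 := le_antisymm hs.2 hs.1
      have ht0 : t = 0 := le_antisymm ht.2 ht.1
      simp [hs0, ht0]
    · field_simp
  · rcases eq_or_ne q r with rfl | hne
    · simp [e0]
    · simp [div_self (dist_pos.2 hne).ne', e1]

/-- For comparison, Stewart is used twice: for `y` on [p, r] seen from `x`, then for `x` on [p, q]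
seen from `r`, which enters with the nonnegative coefficient t. In the plane both steps are
equalities. -/
theorem isCAT0_of_isStewartPoint {X : Type*} [MetricSpace X] [CompleteSpace X]
    (h : ∀ (q r : X), ∀ t ∈ Set.Icc (0 : ℝ) 1, ∃ m, IsStewartPoint q r t m) : IsCAT0 X where
  complete := inferInstance
  geodesic q r := by
    have : Nonempty X := ⟨q⟩
    choose! σ hσ using h q r
    obtain ⟨γ, h1, h2, h3, -⟩ := exists_isGeodesic_of_isStewartPoint hσ
    exact ⟨γ, h1, h2, h3⟩
  comparison := by
    intro p q r x y p' q' r' x' y' hpq hpr hqr hx hx1 hx2 hy hy1 hy2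
    obtain ⟨s, -, hs, hs1, hs2⟩ := exists_isStewartPoint_of_mem_metricSegment h hx
    obtain ⟨t, ht0, ht, ht1, ht2⟩ := exists_isStewartPoint_of_mem_metricSegment h hy
    have ex : x' = AffineMap.lineMap p' q' s := by
      refine eq_lineMap_of_dist_eq_mul_of_dist_eq_mul ?_ ?_
      · rw [hx1, hs1, hpq]
      · rw [hx2, hs2, hpq]
    have ey : y' = AffineMap.lineMap p' r' t := by
      refine eq_lineMap_of_dist_eq_mul_of_dist_eq_mul ?_ ?_
      · rw [hy1, ht1, hpr]
      · rw [hy2, ht2, hpr]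
    have e1 := dist_sq_lineMap x' p' r' t
    have e2 := dist_sq_lineMap r' p' q' s
    rw [← ey, dist_comm x' p', hx1, dist_comm x' r'] at e1
    rw [← ex, dist_comm r' p', dist_comm r' q', hpr, hqr, hpq] at e2
    have i1 := ht x
    have i2 := hs r
    rw [dist_comm x p, dist_comm x r] at i1
    rw [dist_comm r p, dist_comm r q] at i2
    rw [hpr] at e1
    refine abs_le_of_sq_le_sq' ?_ dist_nonneg |>.2
    nlinarith [mul_le_mul_of_nonneg_left (i2.trans_eq e2.symm) ht0.1]

/-! ### A criterion for weak convergence -/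

/-- The hypothesis says that the angle at `x` between `u n` and each fixed `z` is eventually at
least π/2. For a limit `z` of projections, `u n` is no farther from its projection than from `x`;
with the projections tending to `z` this forces d(x, z) = 0. -/
theorem weaklyConverges_of_dist_sq_le {X : Type*} [MetricSpace X] {u : ℕ → X} {x : X}
    (hu : Bornology.IsBounded (Set.range u))
    (h : ∀ z, ∀ᶠ n in Filter.atTop, dist (u n) x ^ 2 + dist x z ^ 2 ≤ dist (u n) z ^ 2) :
    WeaklyConverges u x := by
  refine ⟨hu, fun γ L hγ h0 q hq => ?_⟩
  have hc := hγ.isCompact_image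
  have hx : x ∈ γ '' Set.Icc 0 L := ⟨0, ⟨le_rfl, hγ.1⟩, h0⟩
  refine Filter.tendsto_of_subseq_tendsto fun ns hns => ?_
  obtain ⟨z, -, ms, hms, hz⟩ := hc.tendsto_subseq fun n => (hq (ns n)).1
  refine ⟨ms, ?_⟩
  have hlim : Filter.Tendsto (fun n => ns (ms n)) Filter.atTop Filter.atTop :=
    hns.comp hms.tendsto_atTop
  obtain ⟨R, hR⟩ := (Metric.isBounded_iff_subset_closedBall x).1 hu
  have hR' : ∀ n, dist (u n) x ≤ R := fun n => hR ⟨n, rfl⟩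
  have key : ∀ᶠ n in Filter.atTop, dist x z ^ 2 ≤
      2 * R * dist (q (ns (ms n))) z + dist (q (ns (ms n))) z ^ 2 := by
    filter_upwards [hlim.eventually (h z)] with n hn
    have h1 := (hq (ns (ms n))).2 x hx
    have h2 := dist_triangle (u (ns (ms n))) (q (ns (ms n))) z
    have h3 := hR' (ns (ms n))
    have h4 : dist (u (ns (ms n))) z ≤ dist (u (ns (ms n))) x + dist (q (ns (ms n))) z := by
      linarith
    have h5 := pow_le_pow_left₀ dist_nonneg h4 2
    nlinarith [dist_nonneg (x := q (ns (ms n))) (y := z)]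
  have hd : Filter.Tendsto (fun n => dist (q (ns (ms n))) z) Filter.atTop (𝓝 0) :=
    tendsto_iff_dist_tendsto_zero.1 hz
  have hle : dist x z ^ 2 ≤ 0 := by
    refine ge_of_tendsto ?_ key
    simpa using (hd.const_mul (2 * R)).add (hd.pow 2)
  have : x = z := dist_le_zero.1 (by nlinarith [dist_nonneg (x := x) (y := z)])
  exact this ▸ hz

/-! ### The tree -/

namespace TreeCoord

theorem dist_def (x y : TreeCoord) : dist x y = x.t + y.t - 2 * meet x y := rfl

theorem t_nonneg (x : TreeCoord) : 0 ≤ (x.t : ℝ) := x.t.2.1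

theorem t_le (x : TreeCoord) : (x.t : ℝ) ≤ Real.pi / 2 := x.t.2.2

theorem meet_comm (x y : TreeCoord) : meet x y = meet y x := by
  simp only [meet, overlap_comm x y, min_comm (x.t : ℝ) y.t]

theorem overlap_nonneg (x y : TreeCoord) : 0 ≤ overlap x y := by
  have := Real.pi_pos
  unfold overlap
  split_ifs <;> linarith

theorem meet_nonneg (x y : TreeCoord) : 0 ≤ meet x y :=
  le_min (le_min x.t_nonneg y.t_nonneg) (overlap_nonneg x y)

theorem meet_le_left (x y : TreeCoord) : meet x y ≤ x.t := (min_le_left _ _).trans (min_le_left _ _)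

theorem meet_le_right (x y : TreeCoord) : meet x y ≤ y.t :=
  (min_le_left _ _).trans (min_le_right _ _)

theorem meet_le_overlap (x y : TreeCoord) : meet x y ≤ overlap x y := min_le_right _ _

theorem meet_ultra (x y z : TreeCoord) : min (meet x y) (meet y z) ≤ meet x z := by
  have h := overlap_ultra x y z
  simp only [meet, le_min_iff]
  refine ⟨⟨?_, ?_⟩, le_trans (le_min ?_ ?_) h⟩ <;> simp

theorem dist_le_pi (x y : TreeCoord) : dist x y ≤ Real.pi := by
  rw [dist_def]
  linarith [x.t_le, y.t_le, meet_nonneg x y]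

theorem abs_t_sub_le_dist (x y : TreeCoord) : |(x.t : ℝ) - y.t| ≤ dist x y := by
  rw [dist_def, abs_le]
  constructor <;> linarith [meet_le_left x y, meet_le_right x y]

/-- The four-point condition for trees. -/
theorem dist_add_dist_le_max (v w y z : TreeCoord) :
    dist v w + dist y z ≤ max (dist v y + dist w z) (dist v z + dist w y) := by
  simp only [dist_def]
  -- The heights cancel, and the claim is about sums of meets. These behave like an ultrametric, and
  -- four of its inequalities suffice in every case.
  have h1 := meet_ultra v y w
  have h2 := meet_ultra v z w
  have h3 := meet_ultra y v z
  have h4 := meet_ultra y w z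
  rw [meet_comm y w] at h1 h4
  rw [meet_comm z w] at h2
  rw [meet_comm y v] at h3
  simp only [min_le_iff] at h1 h2 h3 h4
  rw [le_max_iff]
  by_contra! hcon
  obtain ⟨c1, c2⟩ := hcon
  rcases h1 with h1 | h1 <;> rcases h2 with h2 | h2 <;> rcases h3 with h3 | h3 <;>
    rcases h4 with h4 | h4 <;> linarith

theorem overlap_eq_of_eq {x x' : TreeCoord} (hi : x.i = x'.i) (hj : x.j = x'.j) (y : TreeCoord) :
    overlap x y = overlap x' y := by
  simp only [overlap, hi, hj]

theorem dist_eq_abs_of_le_overlap {x y : TreeCoord} (h : min (x.t : ℝ) y.t ≤ overlap x y) :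
    dist x y = |(x.t : ℝ) - y.t| := by
  rw [dist_def, meet, min_eq_left h]
  rcases le_total (x.t : ℝ) y.t with h | h
  · rw [min_eq_left h, abs_of_nonpos (by linarith)]; ring
  · rw [min_eq_right h, abs_of_nonneg (by linarith)]; ring

/-- The overlaps take only three values. -/
theorem exists_overlap_gap (T : ℝ) :
    ∃ δ > 0, ∀ x y : TreeCoord, T - δ < overlap x y → T ≤ overlap x y := by
  have key : ∀ a : ℝ, ∃ δ > 0, T - δ < a → T ≤ a := fun a => by
    by_cases h : T ≤ a
    · exact ⟨1, one_pos, fun _ => h⟩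
    · exact ⟨T - a, by linarith [not_le.1 h], fun h' => by linarith⟩
  obtain ⟨δ₁, h1, h1'⟩ := key (Real.pi / 2)
  obtain ⟨δ₂, h2, h2'⟩ := key (Real.pi / 4)
  obtain ⟨δ₃, h3, h3'⟩ := key 0
  refine ⟨min δ₁ (min δ₂ δ₃), by positivity, fun x y h => ?_⟩
  have e1 := min_le_left δ₁ (min δ₂ δ₃)
  have e2 := (min_le_right δ₁ (min δ₂ δ₃)).trans (min_le_left δ₂ δ₃)
  have e3 := (min_le_right δ₁ (min δ₂ δ₃)).trans (min_le_right δ₂ δ₃)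
  unfold overlap at *
  split_ifs at h ⊢
  · exact h1' (by linarith)
  · exact h2' (by linarith)
  · exact h3' (by linarith)

instance instCompleteSpace : CompleteSpace TreeCoord := by
  refine Metric.complete_of_cauchySeq_tendsto fun u hu => ?_
  have ht : CauchySeq fun n => (u n).t := by
    refine Metric.cauchySeq_iff'.2 fun ε hε => ?_
    obtain ⟨N, hN⟩ := Metric.cauchySeq_iff'.1 hu ε hε
    exact ⟨N, fun n hn => (abs_t_sub_le_dist _ _).trans_lt (hN n hn)⟩
  obtain ⟨T, hT⟩ := cauchySeq_tendsto_of_complete ht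
  obtain ⟨δ, hδ, hgap⟩ := exists_overlap_gap T
  obtain ⟨N₁, hN₁⟩ := Metric.cauchySeq_iff.1 hu (δ / 2) (by positivity)
  obtain ⟨N₂, hN₂⟩ := Metric.tendsto_atTop.1 hT (δ / 2) (by positivity)
  set N := max N₁ N₂ with hN
  -- The overlap with `u N` exceeds T - δ, hence is at least T by the gap. From N on, all paths
  -- share the branch of `u N` up to height T, where the limit sits.
  have hov : ∀ n ≥ N, (T : ℝ) ≤ overlap (u n) (u N) := fun n hn => by
    have h1 := hN₁ n (le_of_max_le_left hn) N (le_max_left _ _)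
    have h2 : |((u n).t : ℝ) - T| < δ / 2 := hN₂ n (le_of_max_le_right hn)
    have h3 : |((u N).t : ℝ) - T| < δ / 2 := hN₂ N (le_max_right _ _)
    rw [dist_def] at h1
    rw [abs_lt] at h2 h3
    refine hgap _ _ ?_
    linarith [meet_le_overlap (u n) (u N)]
  refine ⟨⟨(u N).i, (u N).j, T⟩, ?_⟩
  rw [tendsto_iff_dist_tendsto_zero] at hT ⊢
  refine hT.congr' ?_
  filter_upwards [Filter.eventually_ge_atTop N] with n hn
  symm
  refine dist_eq_abs_of_le_overlap ((min_le_right _ _).trans ?_)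
  exact hov n hn

end TreeCoord

/-! ### Euclidean cones -/

theorem coneDist_sq (a b θ : ℝ) : coneDist a b θ ^ 2 = a ^ 2 + b ^ 2 - 2 * a * b * Real.cos θ := by
  rw [coneDist, Real.sq_sqrt]
  nlinarith [sq_nonneg (a - b * Real.cos θ), Real.sin_sq_add_cos_sq θ,
    sq_nonneg (b * Real.sin θ)]

theorem continuous_coneDist : Continuous fun x : ℝ × ℝ × ℝ => coneDist x.1 x.2.1 x.2.2 := by
  unfold coneDist
  fun_prop

theorem coneDist_self_zero (a : ℝ) : coneDist a a 0 = 0 := by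
  have := coneDist_sq a a 0
  rw [Real.cos_zero] at this
  exact pow_eq_zero_iff two_ne_zero |>.1 (by linarith)

namespace ConeCoord

variable {Y : Type*} [MetricSpace Y]

theorem dist_def (x y : ConeCoord Y) :
    dist x y = coneDist x.radius y.radius (min Real.pi (dist x.direction y.direction)) := rfl

theorem abs_radius_sub_le_dist (x y : ConeCoord Y) : |(x.radius : ℝ) - y.radius| ≤ dist x y := by
  refine abs_le_of_sq_le_sq ?_ dist_nonneg
  rw [dist_def, coneDist_sq]
  nlinarith [Real.cos_le_one (min Real.pi (dist x.direction y.direction)),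
    mul_nonneg x.radius.2 y.radius.2, mul_le_mul_of_nonneg_left
    (Real.cos_le_one (min Real.pi (dist x.direction y.direction)))
    (mul_nonneg x.radius.coe_nonneg y.radius.coe_nonneg)]

theorem continuous_mk : Continuous fun x : ℝ≥0 × Y => (⟨x.1, x.2⟩ : ConeCoord Y) := by
  refine continuous_iff_continuousAt.2 fun x => tendsto_iff_dist_tendsto_zero.2 ?_
  have : Continuous fun z : ℝ≥0 × Y =>
      coneDist z.1 x.1 (min Real.pi (dist z.2 x.2)) :=
    continuous_coneDist.comp (f := fun z : ℝ≥0 × Y =>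
      ((z.1 : ℝ), (x.1 : ℝ), min Real.pi (dist z.2 x.2))) (by fun_prop)
  have h := this.tendsto x
  simp only [dist_self, Real.pi_pos.le, min_eq_right, coneDist_self_zero] at h
  exact h

/-- The radii converge. If their limit is 0, the sequence tends to the tip whatever the directions
do; otherwise the directions are Cauchy, since the chord bounds the angle while the radii stay away
from 0. -/
instance instCompleteSpace [CompleteSpace Y] : CompleteSpace (ConeCoord Y) := by
  refine Metric.complete_of_cauchySeq_tendsto fun u hu => ?_
  have hr : CauchySeq fun n => (u n).radius := by
    refine Metric.cauchySeq_iff'.2 fun ε hε => ?_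
    obtain ⟨N, hN⟩ := Metric.cauchySeq_iff'.1 hu ε hε
    exact ⟨N, fun n hn => (abs_radius_sub_le_dist _ _).trans_lt (hN n hn)⟩
  obtain ⟨R, hR⟩ := cauchySeq_tendsto_of_complete hr
  rcases eq_or_lt_of_le (show 0 ≤ R from R.2) with rfl | hpos
  · refine ⟨⟨0, (u 0).direction⟩, tendsto_iff_dist_tendsto_zero.2 ?_⟩
    have h : ∀ n, dist (u n) ⟨0, (u 0).direction⟩ = (u n).radius := fun n => by
      rw [dist_def, coneDist]
      simp
    simp only [h]
    simpa using NNReal.tendsto_coe.2 hR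
  · have hy : CauchySeq fun n => (u n).direction := by
      have hc : 0 < (R : ℝ) := hpos
      have hbig : ∀ᶠ n in Filter.atTop, R / 2 < (u n).radius :=
        hR.eventually (lt_mem_nhds (NNReal.half_lt_self hpos.ne'))
      obtain ⟨N₁, hN₁⟩ := Filter.eventually_atTop.1 hbig
      refine Metric.cauchySeq_iff'.2 fun ε hε => ?_
      -- Capping at π ensures that a truncated angle below ε' is the actual distance of the
      -- directions.
      set ε' := min ε Real.pi with hε'
      have hε0 : 0 < ε' := lt_min hε Real.pi_pos
      obtain ⟨N₂, hN₂⟩ := Metric.cauchySeq_iff.1 hu (R / Real.pi * ε') (by positivity)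
      refine ⟨max N₁ N₂, fun n hn => ?_⟩
      set N := max N₁ N₂
      have h1 := hN₂ n (le_of_max_le_right hn) N (le_max_right _ _)
      have h2 : (R : ℝ) / 2 < (u n).radius := by exact_mod_cast hN₁ n (le_of_max_le_left hn)
      have h3 : (R : ℝ) / 2 < (u N).radius := by exact_mod_cast hN₁ N (le_max_left _ _)
      set θ := min Real.pi (dist (u n).direction (u N).direction) with hθ
      have hθ0 : 0 ≤ θ := le_min Real.pi_pos.le dist_nonneg
      have hθπ : θ ≤ Real.pi := min_le_left _ _
      have h4 : Real.cos θ ≤ 1 - 2 / Real.pi ^ 2 * θ ^ 2 :=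
        Real.cos_le_one_sub_mul_cos_sq (abs_le.2 ⟨by linarith, hθπ⟩)
      have h5 := coneDist_sq (u n).radius (u N).radius θ
      rw [dist_def, ← hθ] at h1
      have h6 : (R / Real.pi * θ) ^ 2 ≤ coneDist (u n).radius (u N).radius θ ^ 2 := by
        have h7 : ((R : ℝ) / 2) * (R / 2) ≤ (u n).radius * (u N).radius := by
          gcongr
        have h8 : (R / Real.pi * θ) ^ 2 = 2 * ((R : ℝ) / 2 * (R / 2)) * (2 / Real.pi ^ 2 * θ ^ 2) := by
          ring
        rw [h5, h8]
        have h9 : 0 ≤ 2 / Real.pi ^ 2 * θ ^ 2 := by positivity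
        have h10 : 0 ≤ (u n).radius * ((u N).radius : ℝ) := by positivity
        nlinarith [mul_le_mul_of_nonneg_right h7 h9, mul_le_mul_of_nonneg_left h4 h10,
          sq_nonneg (((u n).radius : ℝ) - (u N).radius)]
      have h7 : R / Real.pi * θ < R / Real.pi * ε' :=
        lt_of_le_of_lt (abs_le_of_sq_le_sq' h6 (Real.sqrt_nonneg _)).2 h1
      have h8 : θ < ε' := lt_of_mul_lt_mul_left h7 (by positivity)
      rcases min_lt_iff.1 (hθ ▸ h8 : min Real.pi (dist (u n).direction (u N).direction) < ε')
        with h | h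
      · exact absurd (h.trans_le (min_le_right _ _)) (lt_irrefl _)
      · exact h.trans_le (min_le_left _ _)
    obtain ⟨y, hy⟩ := cauchySeq_tendsto_of_complete hy
    exact ⟨⟨R, y⟩, (continuous_mk.tendsto (R, y)).comp (hR.prodMk_nhds hy)⟩

end ConeCoord

/-! ### Coordinates on the cone over the tree -/

namespace TreeCoord

/-- The coordinates `(0, 0, 0)` of the centre of the tree. -/
def center : TreeCoord := ⟨0, 0, ⟨0, le_rfl, by positivity⟩⟩

theorem dist_center (c : TreeCoord) : dist c center = c.t := by
  have h : meet c center = 0 :=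
    le_antisymm (meet_le_right c center) (meet_nonneg c center)
  rw [dist_def, h]
  simp [center]

theorem dist_eq_zero_iff {c d : TreeCoord} :
    dist c d = 0 ↔ (c.t : ℝ) = d.t ∧ (c.t : ℝ) ≤ overlap c d := by
  constructor
  · intro h
    rw [dist_def] at h
    have h1 := meet_le_left c d
    have h2 := meet_le_right c d
    exact ⟨by linarith, by linarith [meet_le_overlap c d]⟩
  · rintro ⟨h, h'⟩
    rw [dist_eq_abs_of_le_overlap ((min_le_left _ _).trans h'), h]
    simp

theorem sin_nonneg (c : TreeCoord) : 0 ≤ Real.sin c.t :=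
  Real.sin_nonneg_of_nonneg_of_le_pi c.t_nonneg (by linarith [c.t_le, Real.pi_pos])

theorem cos_nonneg (c : TreeCoord) : 0 ≤ Real.cos c.t :=
  Real.cos_nonneg_of_neg_pi_div_two_le_of_le (by linarith [c.t_nonneg, Real.pi_pos]) c.t_le

theorem sin_le_cos_iff (c : TreeCoord) : Real.sin c.t ≤ Real.cos c.t ↔ (c.t : ℝ) ≤ Real.pi / 4 := by
  have h0 := c.t_nonneg
  have h1 := c.t_le
  rw [← Real.sin_pi_div_two_sub, Real.strictMonoOn_sin.le_iff_le ⟨by linarith, by linarith⟩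
    ⟨by linarith, by linarith⟩]
  constructor <;> intro <;> linarith

theorem cos_le_sin_iff (c : TreeCoord) : Real.cos c.t ≤ Real.sin c.t ↔ Real.pi / 4 ≤ (c.t : ℝ) := by
  have h0 := c.t_nonneg
  have h1 := c.t_le
  rw [← Real.sin_pi_div_two_sub, Real.strictMonoOn_sin.le_iff_le ⟨by linarith, by linarith⟩
    ⟨by linarith, by linarith⟩]
  constructor <;> intro <;> linarith

theorem sin_eq_zero_iff (c : TreeCoord) : Real.sin c.t = 0 ↔ (c.t : ℝ) = 0 :=
  Real.sin_eq_zero_iff_of_lt_of_lt (by linarith [c.t_nonneg, Real.pi_pos])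
    (by linarith [c.t_le, Real.pi_pos])

theorem cos_pos_of_le (c : TreeCoord) (h : (c.t : ℝ) ≤ Real.pi / 4) : 0 < Real.cos c.t :=
  Real.cos_pos_of_mem_Ioo ⟨by linarith [c.t_nonneg, Real.pi_pos], by linarith [Real.pi_pos]⟩

end TreeCoord

open TreeCoord

/-- The point of the cone over the tree with radius `r` and direction `c`. -/
def treePoint (r : ℝ≥0) (c : TreeCoord) : EuclideanCone ConeTree :=
  EuclideanCone.point r (SeparationQuotient.mk c)

theorem dist_treePoint (r s : ℝ≥0) (c d : TreeCoord) :
    dist (treePoint r c) (treePoint s d) = coneDist r s (dist c d) := by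
  rw [treePoint, treePoint, EuclideanCone.point, EuclideanCone.point, SeparationQuotient.dist_mk,
    ConeCoord.dist_def, SeparationQuotient.dist_mk, min_eq_right (dist_le_pi c d)]

theorem dist_treePoint_sq (r s : ℝ≥0) (c d : TreeCoord) :
    dist (treePoint r c) (treePoint s d) ^ 2 =
      (r : ℝ) ^ 2 + s ^ 2 - 2 * r * s * Real.cos (dist c d) := by
  rw [dist_treePoint, coneDist_sq]

theorem exists_eq_treePoint (x : EuclideanCone ConeTree) : ∃ r c, x = treePoint r c := by
  obtain ⟨⟨r, y⟩, rfl⟩ := SeparationQuotient.surjective_mk x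
  obtain ⟨c, rfl⟩ := SeparationQuotient.surjective_mk y
  exact ⟨r, c, rfl⟩

/-- The squared distance is (r - s)² + 2rs(1 - cos d), a sum of two nonnegative terms. -/
theorem treePoint_eq_iff {r s : ℝ≥0} {c d : TreeCoord} :
    treePoint r c = treePoint s d ↔ r = s ∧ (r = 0 ∨ dist c d = 0) := by
  rw [← dist_eq_zero, ← sq_eq_zero_iff, dist_treePoint_sq]
  have hc := Real.cos_le_one (dist c d)
  have hrs : 0 ≤ (r : ℝ) * s := by positivity
  constructor
  · intro h
    have h1 : ((r : ℝ) - s) ^ 2 = 0 := by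
      nlinarith [mul_nonneg hrs (sub_nonneg.2 hc), sq_nonneg ((r : ℝ) - s)]
    have h2 : (r : ℝ) = s := by linarith [pow_eq_zero_iff two_ne_zero |>.1 h1]
    refine ⟨NNReal.coe_injective h2, ?_⟩
    rw [← h2] at h
    have h3 : (r : ℝ) ^ 2 * (1 - Real.cos (dist c d)) = 0 := by linarith
    rcases mul_eq_zero.1 h3 with h3 | h3
    · exact Or.inl (NNReal.coe_injective (pow_eq_zero_iff two_ne_zero |>.1 h3))
    · right
      have := Real.injOn_cos ⟨dist_nonneg, dist_le_pi c d⟩ ⟨le_rfl, Real.pi_pos.le⟩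
        (show Real.cos (dist c d) = Real.cos 0 by rw [Real.cos_zero]; linarith)
      exact this
  · rintro ⟨rfl, rfl | h⟩
    · simp
    · rw [h, Real.cos_zero]; ring

/-- The first planar coordinate `r cos t` of a point, after folding the cone over the tree onto a
quadrant. -/
def abscissa (x : EuclideanCone ConeTree) : ℝ :=
  (dist x (treePoint 0 center) ^ 2 + 1 - dist x (treePoint 1 center) ^ 2) / 2

/-- The second planar coordinate `r sin t` of a point, after folding the cone over the tree onto a
quadrant. -/
def ordinate (x : EuclideanCone ConeTree) : ℝ :=
  √(dist x (treePoint 0 center) ^ 2 - abscissa x ^ 2)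

/-- Recovering the planar coordinates from the distances to o and 1·p by the law of cosines makes
them well defined on the quotient and continuous at once. -/
theorem continuous_abscissa : Continuous abscissa := by
  unfold abscissa
  fun_prop

theorem continuous_ordinate : Continuous ordinate := by
  have := continuous_abscissa
  unfold ordinate
  fun_prop

theorem abscissa_treePoint (r : ℝ≥0) (c : TreeCoord) :
    abscissa (treePoint r c) = r * Real.cos c.t := by
  rw [abscissa, dist_treePoint_sq, dist_treePoint_sq, dist_center]
  push_cast
  ring

theorem ordinate_treePoint (r : ℝ≥0) (c : TreeCoord) :
    ordinate (treePoint r c) = r * Real.sin c.t := by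
  rw [ordinate, abscissa_treePoint, dist_treePoint_sq]
  have h : (r : ℝ) ^ 2 + ((0 : ℝ≥0) : ℝ) ^ 2 - 2 * r * ((0 : ℝ≥0) : ℝ) * Real.cos (dist c center)
      - (r * Real.cos c.t) ^ 2 = (r * Real.sin c.t) ^ 2 := by
    push_cast
    linear_combination (-(r : ℝ) ^ 2) * Real.sin_sq_add_cos_sq c.t
  rw [h]
  exact Real.sqrt_sq (mul_nonneg r.coe_nonneg c.sin_nonneg)

/-! ### The triangles -/

theorem sqrt_two_bounds : 1 < √2 ∧ √2 < 2 := by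
  constructor
  · rw [Real.lt_sqrt] <;> norm_num
  · rw [Real.sqrt_lt] <;> norm_num

/-- The third inequality is the side through 2 and (√2, √2). -/
theorem mem_modelTriangle_iff (z : ℂ) :
    z ∈ modelTriangle ↔ 0 ≤ z.im ∧ z.im ≤ z.re ∧ z.re + (√2 - 1) * z.im ≤ 2 := by
  have h2 : √2 * √2 = 2 := Real.mul_self_sqrt (by norm_num)
  obtain ⟨hs1, hs2⟩ := sqrt_two_bounds
  have hv : 2 * Complex.exp ((Real.pi / 4 : ℝ) * Complex.I) = (⟨√2, √2⟩ : ℂ) := by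
    apply Complex.ext
    · rw [show (2 : ℂ) = ((2 : ℝ) : ℂ) by simp, Complex.re_ofReal_mul,
        Complex.exp_ofReal_mul_I_re, Real.cos_pi_div_four]
      ring
    · rw [show (2 : ℂ) = ((2 : ℝ) : ℂ) by simp, Complex.im_ofReal_mul,
        Complex.exp_ofReal_mul_I_im, Real.sin_pi_div_four]
      ring
  rw [modelTriangle, hv]
  constructor
  · intro h
    refine convexHull_min (t := {z : ℂ | 0 ≤ z.im ∧ z.im ≤ z.re ∧ z.re + (√2 - 1) * z.im ≤ 2})
      ?_ ?_ h
    · rintro w (rfl | rfl | rfl)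
      · simp
      · simp
      · refine ⟨?_, ?_, ?_⟩
        · positivity
        · simp
        · simp only
          linarith
    · rintro u ⟨u1, u2, u3⟩ v ⟨v1, v2, v3⟩ a b ha hb hab
      simp only [Set.mem_ofPred_eq, Complex.add_im, Complex.add_re, Complex.smul_re,
        Complex.smul_im, smul_eq_mul]
      refine ⟨by positivity, by gcongr, ?_⟩
      have : a * u.re + b * v.re + (√2 - 1) * (a * u.im + b * v.im) =
        a * (u.re + (√2 - 1) * u.im) + b * (v.re + (√2 - 1) * v.im) := by ring
      rw [this]
      calc _ ≤ a * 2 + b * 2 := by gcongr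
        _ = 2 := by rw [← add_mul, hab, one_mul]
  · rintro ⟨h1, h3, h4⟩
    have hb : z.im * √2 / 2 ≥ 0 := by positivity
    have hsum : (z.re - z.im) / 2 + z.im * √2 / 2 ≤ 1 := by linarith
    -- The weights solve re = 2 w₁ + √2 w₂ and im = √2 w₂; the weight of 0 is the remainder.
    have hmem := (convex_convexHull ℝ {(0 : ℂ), 2, ⟨√2, √2⟩}).sum_mem (t := Finset.univ)
      (w := ![1 - ((z.re - z.im) / 2 + z.im * √2 / 2), (z.re - z.im) / 2, z.im * √2 / 2])
      (z := ![(0 : ℂ), 2, ⟨√2, √2⟩])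
      (fun i _ => by fin_cases i <;> simp <;> linarith)
      (by simp [Fin.sum_univ_three]; ring)
      (fun i _ => subset_convexHull ℝ _ (by fin_cases i <;> simp))
    convert hmem using 1
    apply Complex.ext
    · simp [Fin.sum_univ_three]
      linear_combination (-z.im / 2) * h2
    · simp [Fin.sum_univ_three]
      linear_combination (-z.im / 2) * h2

/-- The edge from o to 2·p, where r sin t = 0, belongs to every inner triangle; the branch index
matters only off it. -/
theorem treePoint_mem_inner_iff {r : ℝ≥0} {c : TreeCoord} {i : ℕ} :
    treePoint r c ∈ coneTriangle (TreeEdge.inner i) ↔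
      r * Real.sin c.t ≤ r * Real.cos c.t ∧
      r * Real.cos c.t + (√2 - 1) * (r * Real.sin c.t) ≤ 2 ∧ (r * Real.sin c.t = 0 ∨ c.i = i) := by
  have hmem : ∀ (ρ : ℝ≥0) (t : ℝ), (ρ : ℂ) * Complex.exp ((t : ℝ) * Complex.I) ∈ modelTriangle ↔
      0 ≤ ρ * Real.sin t ∧ ρ * Real.sin t ≤ ρ * Real.cos t ∧
        ρ * Real.cos t + (√2 - 1) * (ρ * Real.sin t) ≤ 2 := fun ρ t => by
    rw [mem_modelTriangle_iff, show (ρ : ℂ) = ((ρ : ℝ) : ℂ) from rfl, Complex.re_ofReal_mul,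
      Complex.im_ofReal_mul, Complex.exp_ofReal_mul_I_re, Complex.exp_ofReal_mul_I_im]
  constructor
  · rintro ⟨ρ, t, hm, he⟩
    obtain ⟨rfl, h⟩ := treePoint_eq_iff.1 (he : _ = treePoint ρ ⟨i, 0, ⟨t, _⟩⟩)
    obtain ⟨h1, h2, h3⟩ := (hmem _ _).1 hm
    rcases h with rfl | h
    · simp
    · obtain ⟨e1, e2⟩ := dist_eq_zero_iff.1 h
      simp only at e1
      rw [e1]
      refine ⟨h2, h3, ?_⟩
      by_cases hi : c.i = i
      · exact Or.inr hi
      · left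
        simp only [overlap, hi, if_false] at e2
        have : (t : ℝ) = 0 := le_antisymm (e1 ▸ e2) t.2.1
        simp [this]
  · rintro ⟨h1, h2, h3⟩
    have h0 : 0 ≤ r * Real.sin c.t := mul_nonneg r.2 c.sin_nonneg
    rcases eq_or_ne r 0 with rfl | hr
    · exact ⟨0, ⟨0, le_rfl, by positivity⟩, (hmem _ _).2 (by simp),
        treePoint_eq_iff.2 ⟨rfl, Or.inl rfl⟩⟩
    · have hr' : 0 < (r : ℝ) := NNReal.coe_pos.2 (pos_iff_ne_zero.2 hr)
      have ht := (sin_le_cos_iff c).1 (le_of_mul_le_mul_left h1 hr')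
      refine ⟨r, ⟨c.t, c.t_nonneg, ht⟩, (hmem _ _).2 ⟨h0, h1, h2⟩,
        treePoint_eq_iff.2 ⟨rfl, Or.inr (dist_eq_zero_iff.2 ⟨rfl, ?_⟩)⟩⟩
      rcases h3 with h3 | h3
      · exact ((sin_eq_zero_iff c).1 ((mul_eq_zero.1 h3).resolve_left hr'.ne')).le.trans
          (overlap_nonneg _ _)
      · simp only [overlap, h3, if_true]
        split_ifs <;> linarith [c.t_le]

/-- On the ray over b_i, where cosine and sine parts agree, the index `j` is irrelevant. The
alternative r cos t = 0 in the condition on `i` is there for the tip. Rotation by π/4 carries the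
sector to that of the model triangle. -/
theorem treePoint_mem_outer_iff {r : ℝ≥0} {c : TreeCoord} {i j : ℕ} :
    treePoint r c ∈ coneTriangle (TreeEdge.outer i j) ↔
      r * Real.cos c.t ≤ r * Real.sin c.t ∧
      r * Real.sin c.t + (√2 - 1) * (r * Real.cos c.t) ≤ 2 ∧
      (r * Real.cos c.t = 0 ∨ c.i = i) ∧
      (r * Real.cos c.t = r * Real.sin c.t ∨ c.i = i ∧ c.j = j) := by
  have h2 : √2 * √2 = 2 := Real.mul_self_sqrt (by norm_num)
  obtain ⟨hs1, hs2⟩ := sqrt_two_bounds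
  have hmem : ∀ (ρ : ℝ≥0) (t t' : ℝ), t' = Real.pi / 4 + t → 0 ≤ Real.cos t' →
      ((ρ : ℂ) * Complex.exp ((t : ℝ) * Complex.I) ∈ modelTriangle ↔
      ρ * Real.cos t' ≤ ρ * Real.sin t' ∧
        ρ * Real.sin t' + (√2 - 1) * (ρ * Real.cos t') ≤ 2) := fun ρ t t' ht hc => by
    rw [mem_modelTriangle_iff, show (ρ : ℂ) = ((ρ : ℝ) : ℂ) from rfl, Complex.re_ofReal_mul,
      Complex.im_ofReal_mul, Complex.exp_ofReal_mul_I_re, Complex.exp_ofReal_mul_I_im]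
    obtain rfl : t = t' - Real.pi / 4 := by linarith
    rw [Real.cos_sub, Real.sin_sub, Real.cos_pi_div_four, Real.sin_pi_div_four]
    have hc' : 0 ≤ ρ * Real.cos t' := mul_nonneg ρ.2 hc
    have e1 : ρ * (Real.sin t' * (√2 / 2) - Real.cos t' * (√2 / 2)) =
      √2 / 2 * (ρ * Real.sin t' - ρ * Real.cos t') := by ring
    have e2 : ρ * (Real.cos t' * (√2 / 2) + Real.sin t' * (√2 / 2)) =
      √2 / 2 * (ρ * Real.sin t' + ρ * Real.cos t') := by ring
    rw [e1, e2]
    generalize ρ * Real.cos t' = x at *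
    generalize ρ * Real.sin t' = y at *
    have e3 : √2 / 2 * (y + x) + (√2 - 1) * (√2 / 2 * (y - x)) = y + (√2 - 1) * x := by
      linear_combination (y - x) / 2 * h2
    rw [e3]
    constructor
    · rintro ⟨a1, a2, a3⟩
      exact ⟨by nlinarith, a3⟩
    · rintro ⟨a1, a3⟩
      exact ⟨by nlinarith, by nlinarith, a3⟩
  constructor
  · rintro ⟨ρ, t, hm, he⟩
    obtain ⟨rfl, h⟩ := treePoint_eq_iff.1 (he : _ = treePoint ρ ⟨i, j, ⟨Real.pi / 4 + t, _⟩⟩)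
    rcases h with rfl | h
    · simp
    · obtain ⟨e1, e2⟩ := dist_eq_zero_iff.1 h
      simp only at e1
      obtain ⟨h3, h4⟩ := (hmem _ _ _ e1 c.cos_nonneg).1 hm
      have ht := t.2.1
      have hpi := Real.pi_pos
      have hi : c.i = i := by
        by_contra hi
        simp only [overlap, hi, if_false] at e2
        linarith
      refine ⟨h3, h4, Or.inr hi, ?_⟩
      by_cases hj : c.j = j
      · exact Or.inr ⟨hi, hj⟩
      · left
        simp only [overlap, hi, hj, if_false, if_true] at e2
        rw [show (c.t : ℝ) = Real.pi / 4 by linarith, Real.cos_pi_div_four, Real.sin_pi_div_four]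
  · rintro ⟨h1, h2, h3, h4⟩
    rcases eq_or_ne r 0 with rfl | hr
    · exact ⟨0, ⟨0, le_rfl, by positivity⟩, (mem_modelTriangle_iff _).2 (by simp),
        treePoint_eq_iff.2 ⟨rfl, Or.inl rfl⟩⟩
    · have hr' : 0 < (r : ℝ) := NNReal.coe_pos.2 (pos_iff_ne_zero.2 hr)
      have ht := (cos_le_sin_iff c).1 (le_of_mul_le_mul_left h1 hr')
      have hpi := Real.pi_pos
      refine ⟨r, ⟨c.t - Real.pi / 4, by linarith, by linarith [c.t_le]⟩,
        (hmem _ _ c.t (by simp) c.cos_nonneg).2 ⟨h1, h2⟩,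
        treePoint_eq_iff.2 ⟨rfl, Or.inr (dist_eq_zero_iff.2 ⟨by simp, ?_⟩)⟩⟩
      rcases h4 with h4 | ⟨hi, hj⟩
      · have ht' := (sin_le_cos_iff c).1 (le_of_mul_le_mul_left h4.ge hr')
        have hi := h3.resolve_left (mul_pos hr' (c.cos_pos_of_le ht')).ne'
        simp only [overlap, hi, if_true]
        split_ifs <;> linarith
      · simp only [overlap, hi, hj, if_true]
        exact c.t_le

/-- The truncated cone is cut out by two inequalities. -/
theorem exists_mem_coneTriangle_iff (x : EuclideanCone ConeTree) :
    (∃ e, x ∈ coneTriangle e) ↔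
      abscissa x + (√2 - 1) * ordinate x ≤ 2 ∧ ordinate x + (√2 - 1) * abscissa x ≤ 2 := by
  obtain ⟨hs1, hs2⟩ := sqrt_two_bounds
  obtain ⟨r, c, rfl⟩ := exists_eq_treePoint x
  rw [abscissa_treePoint, ordinate_treePoint]
  constructor
  · rintro ⟨i | ⟨i, j⟩, h⟩
    · rw [treePoint_mem_inner_iff] at h
      -- Below the diagonal the second inequality follows from the first, because √2 - 1 < 1; above
      -- it the roles are exchanged.
      exact ⟨h.2.1, by nlinarith [h.1, h.2.1]⟩
    · rw [treePoint_mem_outer_iff] at h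
      exact ⟨by nlinarith [h.1, h.2.1], h.2.1⟩
  · rintro ⟨h1, h2⟩
    rcases le_total (r * Real.sin c.t) (r * Real.cos c.t) with h | h
    · exact ⟨.inner c.i, treePoint_mem_inner_iff.2 ⟨h, h1, Or.inr rfl⟩⟩
    · exact ⟨.outer c.i c.j, treePoint_mem_outer_iff.2 ⟨h, h2, Or.inr rfl, Or.inr ⟨rfl, rfl⟩⟩⟩

/-! ### Completeness, boundedness and separability -/

instance : CompleteSpace TruncatedCone := by
  refine IsClosed.completeSpace_coe (s := {x | ∃ e, x ∈ coneTriangle e}) (hs := ?_)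
  have : {x | ∃ e, x ∈ coneTriangle e} =
      {x | abscissa x + (√2 - 1) * ordinate x ≤ 2} ∩
        {x | ordinate x + (√2 - 1) * abscissa x ≤ 2} :=
    Set.ext exists_mem_coneTriangle_iff
  rw [this]
  have h1 := continuous_abscissa
  have h2 := continuous_ordinate
  exact (isClosed_le (by fun_prop) (by fun_prop)).inter (isClosed_le (by fun_prop) (by fun_prop))

theorem radius_le_of_mem {r : ℝ≥0} {c : TreeCoord} (h : ∃ e, treePoint r c ∈ coneTriangle e) :
    (r : ℝ) ≤ 4 := by
  obtain ⟨hs1, hs2⟩ := sqrt_two_bounds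
  rw [exists_mem_coneTriangle_iff, abscissa_treePoint, ordinate_treePoint] at h
  have h1 : 0 ≤ r * Real.cos c.t := mul_nonneg r.2 c.cos_nonneg
  have h2 : 0 ≤ r * Real.sin c.t := mul_nonneg r.2 c.sin_nonneg
  have h3 : r * Real.cos c.t ≤ 2 := by nlinarith [h.1]
  have h4 : r * Real.sin c.t ≤ 2 := by nlinarith [h.2]
  have h5 := Real.sin_sq_add_cos_sq c.t
  nlinarith [c.sin_nonneg, c.cos_nonneg, r.2, Real.sin_le_one c.t, Real.cos_le_one c.t]

theorem TruncatedCone.isBounded_univ : Bornology.IsBounded (Set.univ : Set TruncatedCone) := by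
  refine (Metric.isBounded_iff_subset_closedBall TruncatedCone.o).2 ⟨4, ?_⟩
  rintro ⟨x, hx⟩ -
  obtain ⟨r, c, rfl⟩ := exists_eq_treePoint x
  have h := dist_treePoint_sq r 0 c center
  have h4 := radius_le_of_mem hx
  rw [Metric.mem_closedBall, Subtype.dist_eq]
  refine (abs_le_of_sq_le_sq' (b := 4) ?_ (by norm_num)).2
  change dist (treePoint r c) (treePoint 0 center) ^ 2 ≤ _
  rw [h]
  push_cast
  nlinarith [r.2]

theorem isCompact_coneTriangle (e : TreeEdge) : IsCompact (coneTriangle e) := by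
  have hparam : Continuous e.param := by
    refine Isometry.continuous (Isometry.of_dist_eq fun s t => ?_)
    cases e with
    | inner i =>
      rw [TreeEdge.param, TreeEdge.param, SeparationQuotient.dist_mk, dist_eq_abs_of_le_overlap]
      · rfl
      · simp only [overlap, if_true]
        exact (min_le_left _ _).trans (by linarith [s.2.2, Real.pi_pos])
    | outer i j =>
      rw [TreeEdge.param, TreeEdge.param, SeparationQuotient.dist_mk, dist_eq_abs_of_le_overlap]
      · simp [Subtype.dist_eq, Real.dist_eq]
      · simp only [overlap, if_true]
        exact (min_le_left _ _).trans (by linarith [s.2.2, Real.pi_pos])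
  have hcont : Continuous fun z : ℝ≥0 × Set.Icc (0 : ℝ) (Real.pi / 4) =>
      EuclideanCone.point z.1 (e.param z.2) :=
    SeparationQuotient.continuous_mk.comp
      (ConeCoord.continuous_mk.comp (f := fun z : ℝ≥0 × Set.Icc (0 : ℝ) (Real.pi / 4) =>
        (z.1, e.param z.2)) (by fun_prop))
  have hK : IsCompact {z : ℝ≥0 × Set.Icc (0 : ℝ) (Real.pi / 4) |
      (z.1 : ℂ) * Complex.exp ((z.2 : ℝ) * Complex.I) ∈ modelTriangle} := by
    refine IsCompact.of_isClosed_subset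
      ((isCompact_Icc (a := (0 : ℝ≥0)) (b := 4)).prod isCompact_univ) ?_ ?_
    · have hclosed : IsClosed modelTriangle := by
        have := Set.Finite.isCompact_convexHull ℝ (s := {(0 : ℂ), 2,
          2 * Complex.exp ((Real.pi / 4 : ℝ) * Complex.I)}) (by simp)
        exact this.isClosed
      exact hclosed.preimage (by fun_prop)
    · rintro ⟨r, t⟩ h
      have hx : EuclideanCone.point r (e.param t) ∈ coneTriangle e := ⟨r, t, h, rfl⟩
      obtain ⟨y, hy⟩ := SeparationQuotient.surjective_mk (e.param t)
      rw [← hy] at hx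
      exact ⟨⟨r.2, by exact_mod_cast radius_le_of_mem ⟨e, hx⟩⟩, trivial⟩
  convert hK.image hcont using 1
  ext x
  constructor
  · rintro ⟨r, t, h, rfl⟩
    exact ⟨(r, t), h, rfl⟩
  · rintro ⟨⟨r, t⟩, h, rfl⟩
    exact ⟨r, t, h, rfl⟩

instance : Countable TreeEdge :=
  Function.Injective.countable (f := fun e : TreeEdge => match e with
    | .inner i => (Sum.inl i : ℕ ⊕ ℕ × ℕ)
    | .outer i j => Sum.inr (i, j)) (by rintro (_ | _) (_ | _) h <;> simp_all)

theorem TruncatedCone.separableSpace : TopologicalSpace.SeparableSpace TruncatedCone := by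
  refine TopologicalSpace.IsSeparable.separableSpace (s := {x | ∃ e, x ∈ coneTriangle e}) ?_
  rw [Set.ofPred_exists]
  exact .iUnion fun e => (isCompact_coneTriangle e).isSeparable

/-! ### Geodesics of the truncated cone -/

/-- Polar coordinates of a point of a planar segment whose ends have the polar angles `α`
and `-β`. -/
theorem exists_polar_of_segment {a b α β s : ℝ} (ha : 0 ≤ a) (hb : 0 ≤ b) (hα : 0 ≤ α)
    (hα' : α ≤ Real.pi / 2) (hβ : 0 ≤ β) (hβ' : β ≤ Real.pi / 2) (hs : s ∈ Set.Icc (0 : ℝ) 1) :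
    ∃ (ρ : ℝ≥0) (ψ : ℝ), -β ≤ ψ ∧ ψ ≤ α ∧
      ρ * Real.cos ψ = (1 - s) * (a * Real.cos α) + s * (b * Real.cos β) ∧
      ρ * Real.sin ψ = (1 - s) * (a * Real.sin α) - s * (b * Real.sin β) := by
  have hpi := Real.pi_pos
  have hs0 := hs.1
  have hs1 : 0 ≤ 1 - s := by linarith [hs.2]
  set z : ℂ := ⟨(1 - s) * (a * Real.cos α) + s * (b * Real.cos β),
    (1 - s) * (a * Real.sin α) - s * (b * Real.sin β)⟩ with hz
  rcases eq_or_ne z 0 with h0 | h0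
  · refine ⟨0, α, by linarith, le_rfl, ?_, ?_⟩
    · simpa using (congrArg Complex.re h0).symm
    · simpa using (congrArg Complex.im h0).symm
  have hρ : 0 < ‖z‖ := norm_pos_iff.2 h0
  have hre : ‖z‖ * Real.cos z.arg = (1 - s) * (a * Real.cos α) + s * (b * Real.cos β) :=
    Complex.norm_mul_cos_arg z
  have him : ‖z‖ * Real.sin z.arg = (1 - s) * (a * Real.sin α) - s * (b * Real.sin β) :=
    Complex.norm_mul_sin_arg z
  have hcα : 0 ≤ Real.cos α := Real.cos_nonneg_of_neg_pi_div_two_le_of_le (by linarith) hα'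
  have hcβ : 0 ≤ Real.cos β := Real.cos_nonneg_of_neg_pi_div_two_le_of_le (by linarith) hβ'
  have harg : |z.arg| ≤ Real.pi / 2 :=
    Complex.abs_arg_le_pi_div_two_iff.2 (show 0 ≤ (1 - s) * (a * Real.cos α) + s * (b * Real.cos β)
      by positivity)
  rw [abs_le] at harg
  have hsin : 0 ≤ Real.sin (α + β) :=
    Real.sin_nonneg_of_nonneg_of_le_pi (by linarith) (by linarith)
  -- `e1` and `e2` are the cross products of the point with the two ends; their signs confine its
  -- argument to [-β, α].
  have e1 : ‖z‖ * Real.sin (α - z.arg) = s * b * Real.sin (α + β) := by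
    rw [Real.sin_sub, Real.sin_add]
    linear_combination Real.sin α * hre - Real.cos α * him
  have e2 : ‖z‖ * Real.sin (z.arg + β) = (1 - s) * a * Real.sin (α + β) := by
    rw [Real.sin_add, Real.sin_add]
    linear_combination Real.sin β * hre + Real.cos β * him
  have key : ∀ θ : ℝ, -(Real.pi / 2) ≤ θ → 0 ≤ ‖z‖ * Real.sin θ → 0 ≤ θ := fun θ h1 h2 => by
    by_contra! h
    have := Real.sin_neg_of_neg_of_neg_pi_lt h (by linarith)
    nlinarith
  refine ⟨⟨‖z‖, norm_nonneg z⟩, z.arg, ?_, ?_, hre, him⟩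
  · linarith [key (z.arg + β) (by linarith) (e2 ▸ by positivity)]
  · linarith [key (α - z.arg) (by linarith) (e1 ▸ by positivity)]

/-- The path from `d` to `c` in the tree, parametrized so that the point closest to the centre has
the parameter `0`. -/
theorem TreeCoord.exists_mem_path {c d : TreeCoord} {ψ : ℝ} (h1 : -(d.t - meet c d) ≤ ψ)
    (h2 : ψ ≤ c.t - meet c d) :
    ∃ w : TreeCoord, (w.i = c.i ∧ w.j = c.j ∨ w.i = d.i ∧ w.j = d.j) ∧
      (w.t : ℝ) = meet c d + |ψ| ∧ dist w c = c.t - meet c d - ψ ∧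
      dist w d = d.t - meet c d + ψ := by
  have key : ∀ {c d : TreeCoord} {ψ : ℝ}, 0 ≤ ψ → ψ ≤ c.t - meet c d →
      ∃ w : TreeCoord, w.i = c.i ∧ w.j = c.j ∧
      (w.t : ℝ) = meet c d + ψ ∧ dist w c = c.t - meet c d - ψ ∧
      dist w d = d.t - meet c d + ψ := fun {c d ψ} h0 h => by
    have hm := meet_nonneg c d
    refine ⟨⟨c.i, c.j, ⟨meet c d + ψ, by linarith, by linarith [c.t_le]⟩⟩, rfl, rfl, rfl, ?_, ?_⟩
    · rw [dist_eq_abs_of_le_overlap, abs_of_nonpos]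
      · ring
      · linarith
      · simp only [overlap, if_true]
        exact (min_le_right _ _).trans c.t_le
    · have hmeet : meet ⟨c.i, c.j, ⟨meet c d + ψ, by linarith, by linarith [c.t_le]⟩⟩ d =
          meet c d := by
        have hov : overlap ⟨c.i, c.j, ⟨meet c d + ψ, by linarith, by linarith [c.t_le]⟩⟩ d =
          overlap c d := overlap_eq_of_eq rfl rfl d
        apply le_antisymm
        · conv_rhs => rw [meet]
          refine le_min (le_min ?_ (meet_le_right _ _)) (hov ▸ meet_le_overlap _ _)
          exact (meet_le_left _ _).trans (by linarith)
        · conv_rhs => rw [meet]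
          exact le_min (le_min (by linarith) (meet_le_right _ _)) (hov ▸ meet_le_overlap _ _)
      rw [dist_def, hmeet]
      ring
  rcases le_total 0 ψ with h | h
  · obtain ⟨w, hi, hj, ht, hc, hd⟩ := key h h2
    exact ⟨w, Or.inl ⟨hi, hj⟩, by rw [ht, abs_of_nonneg h], hc, hd⟩
  · rw [meet_comm c d] at h1 ⊢
    obtain ⟨w, hi, hj, ht, hc, hd⟩ := key (neg_nonneg.2 h) (by linarith : -ψ ≤ d.t - meet d c)
    exact ⟨w, Or.inr ⟨hi, hj⟩, by rw [ht, abs_of_nonpos h], by linarith, by linarith⟩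

/-- Stewart's inequality in the cone over the tree. -/
theorem dist_treePoint_sq_le {a b ρ l : ℝ≥0} {c d w : TreeCoord} {α β ψ s : ℝ}
    (hs : s ∈ Set.Icc (0 : ℝ) 1)
    (hcd : dist c d = α + β) (hwc : dist w c = α - ψ) (hwd : dist w d = β + ψ)
    (hre : ρ * Real.cos ψ = (1 - s) * (a * Real.cos α) + s * (b * Real.cos β))
    (him : ρ * Real.sin ψ = (1 - s) * (a * Real.sin α) - s * (b * Real.sin β)) (v : TreeCoord) :
    dist (treePoint l v) (treePoint ρ w) ^ 2 ≤
      (1 - s) * dist (treePoint l v) (treePoint a c) ^ 2 +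
      s * dist (treePoint l v) (treePoint b d) ^ 2 -
      s * (1 - s) * dist (treePoint a c) (treePoint b d) ^ 2 := by
  have hs0 := hs.1
  have hs1 : 0 ≤ 1 - s := by linarith [hs.2]
  simp only [dist_treePoint_sq, hcd]
  have hρ : (ρ : ℝ) ^ 2 = (1 - s) ^ 2 * a ^ 2 + s ^ 2 * b ^ 2 +
      2 * s * (1 - s) * a * b * Real.cos (α + β) := by
    have : (ρ : ℝ) ^ 2 = (ρ * Real.cos ψ) ^ 2 + (ρ * Real.sin ψ) ^ 2 := by
      linear_combination (-(ρ : ℝ) ^ 2) * Real.sin_sq_add_cos_sq ψ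
    rw [this, hre, him, Real.cos_add]
    linear_combination (1 - s) ^ 2 * a ^ 2 * Real.sin_sq_add_cos_sq α +
      s ^ 2 * b ^ 2 * Real.sin_sq_add_cos_sq β
  -- With the planar value of ρ² inserted, all squares cancel and only the terms linear in `l`
  -- remain.
  suffices hmain : l * ((1 - s) * (a * Real.cos (dist v c)) + s * (b * Real.cos (dist v d))) ≤
      l * (ρ * Real.cos (dist v w)) by
    rw [hρ]
    linarith
  refine mul_le_mul_of_nonneg_left ?_ l.2
  -- χ is the angle that replaces `v` in the unfolded plane, where the inequality becomes the
  -- linearity of the inner product along the segment.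
  have key : ∀ χ : ℝ, dist v w ≤ |χ - ψ| → |χ - ψ| ≤ Real.pi → |χ - α| ≤ dist v c →
      |χ + β| ≤ dist v d → (1 - s) * (a * Real.cos (dist v c)) + s * (b * Real.cos (dist v d)) ≤
      ρ * Real.cos (dist v w) := fun χ h1 h2 h3 h4 => by
    have i1 := Real.cos_le_cos_of_nonneg_of_le_pi dist_nonneg h2 h1
    have i2 := Real.cos_le_cos_of_nonneg_of_le_pi (abs_nonneg _) (dist_le_pi v c) h3
    have i3 := Real.cos_le_cos_of_nonneg_of_le_pi (abs_nonneg _) (dist_le_pi v d) h4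
    rw [Real.cos_abs] at i1 i2 i3
    calc (1 - s) * (a * Real.cos (dist v c)) + s * (b * Real.cos (dist v d))
        ≤ (1 - s) * (a * Real.cos (χ - α)) + s * (b * Real.cos (χ + β)) := by gcongr
      _ = ρ * Real.cos (χ - ψ) := by
        rw [Real.cos_sub, Real.cos_sub, Real.cos_add]
        linear_combination (-Real.cos χ) * hre - Real.sin χ * him
      _ ≤ ρ * Real.cos (dist v w) := by gcongr
  have t1 := dist_triangle v c d
  have t2 := dist_triangle v d c
  have t3 := dist_triangle c v d
  rw [dist_comm d c] at t2
  rw [dist_comm c v] at t3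
  have p1 := dist_le_pi v c
  have p2 := dist_le_pi v d
  have n1 := dist_nonneg (x := v) (y := w)
  have n2 := dist_nonneg (x := w) (y := c)
  have n3 := dist_nonneg (x := w) (y := d)
  -- The four-point condition tells from which end χ is measured: in the first case it has its exact
  -- distance to `c`, in the second to `d`.
  rcases le_max_iff.1 (dist_add_dist_le_max v w c d) with h | h
  · refine key (α - dist v c) ?_ ?_ ?_ ?_
    · rw [abs_of_nonpos (by linarith)]; linarith
    · rw [abs_of_nonpos (by linarith)]; linarith
    · rw [abs_of_nonpos (by linarith [dist_nonneg (x := v) (y := c)])]; linarith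
    · rw [abs_le]; constructor <;> linarith
  · refine key (dist v d - β) ?_ ?_ ?_ ?_
    · rw [abs_of_nonneg (by linarith)]; linarith
    · rw [abs_of_nonneg (by linarith)]; linarith
    · rw [abs_le]; constructor <;> linarith
    · rw [abs_of_nonneg (by linarith [dist_nonneg (x := v) (y := d)])]; linarith

/-- The truncated cone is convex in the cone. -/
theorem exists_mem_coneTriangle_of_polar {a b ρ : ℝ≥0} {c d w : TreeCoord} {ψ s : ℝ}
    (hs : s ∈ Set.Icc (0 : ℝ) 1)
    (hc : ∃ e, treePoint a c ∈ coneTriangle e) (hd : ∃ e, treePoint b d ∈ coneTriangle e)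
    (hψ : -(d.t - meet c d) ≤ ψ) (hψ' : ψ ≤ c.t - meet c d)
    (hre : ρ * Real.cos ψ =
      (1 - s) * (a * Real.cos (c.t - meet c d)) + s * (b * Real.cos (d.t - meet c d)))
    (him : ρ * Real.sin ψ =
      (1 - s) * (a * Real.sin (c.t - meet c d)) - s * (b * Real.sin (d.t - meet c d)))
    (hw : (w.t : ℝ) = meet c d + |ψ|) : ∃ e, treePoint ρ w ∈ coneTriangle e := by
  obtain ⟨hk1, hk2⟩ := sqrt_two_bounds
  have hpi := Real.pi_pos
  have hs0 := hs.1
  have hs1 : 0 ≤ 1 - s := by linarith [hs.2]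
  rw [exists_mem_coneTriangle_iff, abscissa_treePoint, ordinate_treePoint] at hc hd ⊢
  have hα0 : 0 ≤ c.t - meet c d := by linarith [meet_le_left c d]
  have hβ0 : 0 ≤ d.t - meet c d := by linarith [meet_le_right c d]
  have hcα : (c.t : ℝ) = meet c d + (c.t - meet c d) := by ring
  have hdβ : (d.t : ℝ) = meet c d + (d.t - meet c d) := by ring
  have hα1 : c.t - meet c d ≤ Real.pi / 2 := by linarith [meet_nonneg c d, c.t_le]
  have hβ1 : d.t - meet c d ≤ Real.pi / 2 := by linarith [meet_nonneg c d, d.t_le]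
  set t₀ := meet c d with ht₀
  set α := (c.t : ℝ) - t₀
  set β := (d.t : ℝ) - t₀
  have hsα : 0 ≤ a * Real.sin α :=
    mul_nonneg a.2 (Real.sin_nonneg_of_nonneg_of_le_pi hα0 (by linarith))
  have hsβ : 0 ≤ b * Real.sin β :=
    mul_nonneg b.2 (Real.sin_nonneg_of_nonneg_of_le_pi hβ0 (by linarith))
  have hcos : ρ * Real.cos |ψ| = (1 - s) * (a * Real.cos α) + s * (b * Real.cos β) := by
    rw [Real.cos_abs, hre]
  have hsin_abs : ρ * Real.sin |ψ| = |ρ * Real.sin ψ| := by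
    have : |ψ| ≤ Real.pi := abs_le.2 ⟨by linarith, by linarith⟩
    rw [abs_mul, abs_of_nonneg ρ.coe_nonneg, Real.abs_sin_eq_sin_abs_of_abs_le_pi this]
  have hsin_le : ρ * Real.sin |ψ| ≤ (1 - s) * (a * Real.sin α) + s * (b * Real.sin β) := by
    have h1 : 0 ≤ (1 - s) * (a * Real.sin α) := by positivity
    have h2 : 0 ≤ s * (b * Real.sin β) := by positivity
    rw [hsin_abs, him, abs_le]
    constructor <;> linarith
  rw [hw, Real.cos_add, Real.sin_add]
  rw [hcα, Real.cos_add, Real.sin_add] at hc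
  rw [hdβ, Real.cos_add, Real.sin_add] at hd
  -- Along the unfolded segment ρ cos|ψ| is affine, while ρ sin|ψ| lies below the affine
  -- interpolation because of the fold. A linear bound thus survives if the sine coefficient H is
  -- nonnegative or if no fold occurs.
  have lin : ∀ G H : ℝ, 0 ≤ H ∨
      ρ * Real.sin |ψ| = (1 - s) * (a * Real.sin α) + s * (b * Real.sin β) →
      G * (a * Real.cos α) + H * (a * Real.sin α) ≤ 2 →
      G * (b * Real.cos β) + H * (b * Real.sin β) ≤ 2 →
      G * (ρ * Real.cos |ψ|) + H * (ρ * Real.sin |ψ|) ≤ 2 := fun G H hH h1 h2 => by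
    have h3 : H * (ρ * Real.sin |ψ|) ≤ H * ((1 - s) * (a * Real.sin α) + s * (b * Real.sin β)) := by
      rcases hH with hH | hH
      · exact mul_le_mul_of_nonneg_left hsin_le hH
      · rw [hH]
    rw [hcos]
    nlinarith [mul_le_mul_of_nonneg_left h1 hs1, mul_le_mul_of_nonneg_left h2 hs0]
  have lin1 : 0 ≤ (√2 - 1) * Real.cos t₀ - Real.sin t₀ ∨
      ρ * Real.sin |ψ| = (1 - s) * (a * Real.sin α) + s * (b * Real.sin β) →
      ρ * (Real.cos t₀ * Real.cos |ψ| - Real.sin t₀ * Real.sin |ψ|) +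
      (√2 - 1) * (ρ * (Real.sin t₀ * Real.cos |ψ| + Real.cos t₀ * Real.sin |ψ|)) ≤ 2 := fun h => by
    have := lin (Real.cos t₀ + (√2 - 1) * Real.sin t₀) _ h (by linarith [hc.1]) (by linarith [hd.1])
    linarith
  have lin2 : 0 ≤ Real.cos t₀ - (√2 - 1) * Real.sin t₀ ∨
      ρ * Real.sin |ψ| = (1 - s) * (a * Real.sin α) + s * (b * Real.sin β) →
      ρ * (Real.sin t₀ * Real.cos |ψ| + Real.cos t₀ * Real.sin |ψ|) +
      (√2 - 1) * (ρ * (Real.cos t₀ * Real.cos |ψ| - Real.sin t₀ * Real.sin |ψ|)) ≤ 2 := fun h => by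
    have := lin (Real.sin t₀ + (√2 - 1) * Real.cos t₀) _ h (by linarith [hc.2]) (by linarith [hd.2])
    linarith
  -- If one end has its direction on the path from p to the other's, the segment is not folded and
  -- both bounds are immediate. Otherwise the paths separate at p or at some b_i, so t₀ is 0 or π/4.
  by_cases hα : α = 0
  · have hψ0 : ψ ≤ 0 := hα ▸ hψ'
    have : ρ * Real.sin |ψ| = (1 - s) * (a * Real.sin α) + s * (b * Real.sin β) := by
      rw [abs_of_nonpos hψ0, Real.sin_neg, hα, Real.sin_zero]
      rw [hα, Real.sin_zero] at him
      linarith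
    exact ⟨lin1 (Or.inr this), lin2 (Or.inr this)⟩
  by_cases hβ : β = 0
  · have hψ0 : 0 ≤ ψ := by linarith
    have : ρ * Real.sin |ψ| = (1 - s) * (a * Real.sin α) + s * (b * Real.sin β) := by
      rw [abs_of_nonneg hψ0, hβ, Real.sin_zero]
      rw [hβ, Real.sin_zero] at him
      linarith
    exact ⟨lin1 (Or.inr this), lin2 (Or.inr this)⟩
  have hov : t₀ = overlap c d := by
    rw [ht₀, meet]
    refine min_eq_right (not_lt.1 fun hlt => ?_)
    have : t₀ = min (c.t : ℝ) d.t := by rw [ht₀, meet, min_eq_left hlt.le]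
    rcases min_choice (c.t : ℝ) d.t with h | h
    · exact hα (by simp only [α]; linarith)
    · exact hβ (by simp only [β]; linarith)
  have hlt : t₀ < Real.pi / 2 := by
    have : 0 < α := lt_of_le_of_ne hα0 (Ne.symm hα)
    have := c.t_le
    linarith
  have hcases : t₀ = 0 ∨ t₀ = Real.pi / 4 := by
    rw [hov] at hlt ⊢
    unfold overlap at hlt ⊢
    split_ifs at hlt ⊢
    · exact absurd hlt (lt_irrefl _)
    · exact Or.inr rfl
    · exact Or.inl rfl
  rcases hcases with h0 | h0
  · refine ⟨lin1 (Or.inl ?_), lin2 (Or.inl ?_)⟩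
    · rw [h0]; simp
    · rw [h0]; simp
  · have h2 := lin2 (Or.inl (by
      rw [h0, Real.cos_pi_div_four, Real.sin_pi_div_four]; nlinarith))
    -- For t₀ = π/4 the first bound has a negative sine coefficient, but the point lies beyond angle
    -- π/4, where the second bound implies the first.
    refine ⟨?_, h2⟩
    have hle : Real.cos w.t ≤ Real.sin w.t := by
      rw [cos_le_sin_iff, hw]; linarith [abs_nonneg ψ]
    rw [hw, Real.cos_add, Real.sin_add] at hle
    have h3 := mul_le_mul_of_nonneg_left hle ρ.coe_nonneg
    linarith [mul_le_mul_of_nonneg_left h3 (by linarith : 0 ≤ 2 - √2)]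

/-- The points of the segments of the truncated cone; they lie over the branches of the ends. -/
theorem TruncatedCone.exists_isStewartPoint {a b : ℝ≥0} {c d : TreeCoord}
    (hc : ∃ e, treePoint a c ∈ coneTriangle e) (hd : ∃ e, treePoint b d ∈ coneTriangle e)
    {s : ℝ} (hs : s ∈ Set.Icc (0 : ℝ) 1) :
    ∃ m : TruncatedCone, IsStewartPoint (⟨treePoint a c, hc⟩ : TruncatedCone) ⟨treePoint b d, hd⟩ s m ∧
      ∃ ρ w, m.1 = treePoint ρ w ∧ (w.i = c.i ∧ w.j = c.j ∨ w.i = d.i ∧ w.j = d.j) := by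
  have hm := meet_nonneg c d
  obtain ⟨ρ, ψ, h1, h2, hre, him⟩ := exists_polar_of_segment a.2 b.2
    (sub_nonneg.2 (meet_le_left c d)) (by linarith [c.t_le])
    (sub_nonneg.2 (meet_le_right c d)) (by linarith [d.t_le]) hs
  obtain ⟨w, hij, ht, hwc, hwd⟩ := exists_mem_path h1 h2
  refine ⟨⟨treePoint ρ w, exists_mem_coneTriangle_of_polar hs hc hd h1 h2 hre him ht⟩, ?_,
    ρ, w, rfl, hij⟩
  rintro ⟨p, hp⟩
  obtain ⟨l, v, rfl⟩ := exists_eq_treePoint p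
  exact dist_treePoint_sq_le hs (by rw [dist_def]; ring) hwc hwd hre him v

theorem TruncatedCone.isCAT0 : IsCAT0 TruncatedCone := by
  refine isCAT0_of_isStewartPoint ?_
  rintro ⟨q, hq⟩ ⟨r, hr⟩ t ht
  obtain ⟨a, c, rfl⟩ := exists_eq_treePoint q
  obtain ⟨b, d, rfl⟩ := exists_eq_treePoint r
  obtain ⟨m, hm, -⟩ := exists_isStewartPoint hq hr ht
  exact ⟨m, hm⟩

/-! ### The weak topology is not Hausdorff -/

/-- Otherwise a subsequence stays in the weakly closed complement, which then contains its weak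
limit. -/
theorem WeaklyConverges.eventually_mem {X : Type*} [MetricSpace X] {u : ℕ → X} {x : X}
    (h : WeaklyConverges u x) {U : Set X} (hU : IsOpen[weakTopology X] U) (hx : x ∈ U) :
    ∀ᶠ n in Filter.atTop, u n ∈ U := by
  have hc : IsWeaklyClosed Uᶜ := hU
  by_contra hcon
  obtain ⟨φ, hφ, hφU⟩ := Filter.extraction_of_frequently_atTop (Filter.not_eventually.1 hcon)
  exact hc (u ∘ φ) x hφU (h.comp hφ) hx

/-- The point l'·v is the foot of the perpendicular from l·y to the ray over v, and the direction w
lies beyond v as seen from y. The two sides differ by 2 l r sin ω sin d(v, w) ≥ 0. -/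
theorem dist_treePoint_sq_add_le {l l' r : ℝ≥0} {y v w : TreeCoord} {ω : ℝ} (hω : 0 ≤ Real.sin ω)
    (hl : (l' : ℝ) = l * Real.cos ω) (hyv : dist y v = ω) (hyw : dist y w = ω + dist v w) :
    dist (treePoint l y) (treePoint l' v) ^ 2 + dist (treePoint l' v) (treePoint r w) ^ 2 ≤
      dist (treePoint l y) (treePoint r w) ^ 2 := by
  rw [dist_treePoint_sq, dist_treePoint_sq, dist_treePoint_sq, hyw, hyv, hl, Real.cos_add]
  have h1 : 0 ≤ Real.sin (dist v w) :=
    Real.sin_nonneg_of_nonneg_of_le_pi dist_nonneg (dist_le_pi v w)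
  have h2 : 0 ≤ l * r * (Real.sin ω * Real.sin (dist v w)) := by positivity
  linarith

theorem exists_treePoint_mem_of_le_one {r : ℝ≥0} (hr : r ≤ 1) (c : TreeCoord) :
    ∃ e, treePoint r c ∈ coneTriangle e := by
  obtain ⟨hk1, hk2⟩ := sqrt_two_bounds
  have hr' : (r : ℝ) ≤ 1 := by exact_mod_cast hr
  have h1 : r * Real.cos c.t ≤ 1 :=
    mul_le_one₀ hr' c.cos_nonneg (Real.cos_le_one _)
  have h2 : r * Real.sin c.t ≤ 1 :=
    mul_le_one₀ hr' c.sin_nonneg (Real.sin_le_one _)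
  rw [exists_mem_coneTriangle_iff, abscissa_treePoint, ordinate_treePoint]
  constructor <;> nlinarith

namespace TruncatedCone

/-- The point `e i j` of the truncated cone. -/
def outerPoint (i j : ℕ) : TruncatedCone :=
  ⟨treePoint 1 ⟨i, j, ⟨Real.pi / 2, by positivity, le_rfl⟩⟩, exists_treePoint_mem_of_le_one le_rfl _⟩

/-- The point `(√2 / 2) · b i` of the truncated cone. -/
def innerPoint (i : ℕ) : TruncatedCone :=
  ⟨treePoint (NNReal.sqrt 2 / 2) ⟨i, 0, ⟨Real.pi / 4, by positivity, by linarith [Real.pi_pos]⟩⟩,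
    exists_treePoint_mem_of_le_one (by
      rw [← NNReal.coe_le_coe]
      push_cast
      linarith [sqrt_two_bounds.2]) _⟩

theorem meet_eq_zero_of_ne {c d : TreeCoord} (h : c.i ≠ d.i) : meet c d = 0 := by
  refine le_antisymm ((meet_le_overlap c d).trans ?_) (meet_nonneg c d)
  simp [overlap, h]

theorem weaklyConverges_of_dist_sq_le {u : ℕ → TruncatedCone} {x : TruncatedCone}
    (h : ∀ (r : ℝ≥0) (w : TreeCoord), ∀ᶠ n in Filter.atTop,
      dist (u n).1 x.1 ^ 2 + dist x.1 (treePoint r w) ^ 2 ≤ dist (u n).1 (treePoint r w) ^ 2) :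
    WeaklyConverges u x := by
  refine _root_.weaklyConverges_of_dist_sq_le (isBounded_univ.subset (Set.subset_univ _)) ?_
  rintro ⟨z, hz⟩
  obtain ⟨r, w, rfl⟩ := exists_eq_treePoint z
  exact h r w

/-- The foot is ½·p since (√2/2) cos(π/4) = 1/2. A test point lies over one branch at p; from every
other b_n its direction is reached through p. -/
theorem weaklyConverges_innerPoint : WeaklyConverges innerPoint halfP := by
  have hpi := Real.pi_pos
  have h2 : √2 * √2 = 2 := Real.mul_self_sqrt (by norm_num)
  refine weaklyConverges_of_dist_sq_le fun r w => ?_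
  filter_upwards [Filter.eventually_ne_atTop w.i] with n hn
  refine dist_treePoint_sq_add_le (v := center) (ω := Real.pi / 4)
    (Real.sin_nonneg_of_nonneg_of_le_pi (by positivity) (by linarith)) ?_ (dist_center _) ?_
  · rw [Real.cos_pi_div_four]
    push_cast
    linarith
  · rw [dist_comm center, dist_center, dist_def, meet_eq_zero_of_ne hn]
    simp

theorem weaklyConverges_outerPoint (i : ℕ) : WeaklyConverges (outerPoint i) (innerPoint i) := by
  have hpi := Real.pi_pos
  refine weaklyConverges_of_dist_sq_le fun r w => ?_
  filter_upwards [Filter.eventually_ne_atTop w.j] with j hj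
  refine dist_treePoint_sq_add_le (ω := Real.pi / 4)
    (Real.sin_nonneg_of_nonneg_of_le_pi (by positivity) (by linarith)) ?_ ?_ ?_
  · rw [Real.cos_pi_div_four]
    simp
  · rw [dist_eq_abs_of_le_overlap]
    · rw [abs_of_nonneg (by simp only; linarith)]
      simp only
      ring
    · simp only [overlap, if_true]
      refine (min_le_right _ _).trans ?_
      split_ifs <;> linarith
  -- Whether or not `w` lies over b_i, the paths to e_ij and to b_i separate from the path to `w` at
  -- the same point, because `j` differs from `w.j`.
  · by_cases hi : i = w.i
    · have e1 : meet ⟨i, j, ⟨Real.pi / 2, by positivity, le_rfl⟩⟩ w = min (w.t : ℝ) (Real.pi / 4) := by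
        simp only [meet, overlap, hi, hj, if_true, if_false, min_eq_right w.t_le]
      have e2 : meet ⟨i, 0, ⟨Real.pi / 4, by positivity, by linarith⟩⟩ w =
          min (w.t : ℝ) (Real.pi / 4) := by
        simp only [meet, overlap, hi, if_true]
        rw [min_comm (Real.pi / 4), min_eq_left]
        refine (min_le_right _ _).trans ?_
        split_ifs <;> linarith
      rw [dist_def, dist_def, e1, e2]
      ring
    · rw [dist_def, dist_def, meet_eq_zero_of_ne hi, meet_eq_zero_of_ne hi]
      ring

/-- Directions over different branches at p are at distance π/2 from p, so the foot is the tip. The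
choice of `f` plays no role, which permits the diagonal argument. -/
theorem weaklyConverges_outerPoint_o (f : ℕ → ℕ) :
    WeaklyConverges (fun i => outerPoint i (f i)) o := by
  have hpi := Real.pi_pos
  refine weaklyConverges_of_dist_sq_le fun r w => ?_
  filter_upwards [Filter.eventually_ne_atTop w.i] with n hn
  refine dist_treePoint_sq_add_le (v := center) (ω := Real.pi / 2)
    (Real.sin_nonneg_of_nonneg_of_le_pi (by positivity) (by linarith)) ?_ (dist_center _) ?_
  · simp
  · rw [dist_comm center, dist_center, dist_def, meet_eq_zero_of_ne hn]
    simp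

theorem not_exists_disjoint_weak_nhds :
    ¬ ∃ U V : Set TruncatedCone,
      IsOpen[weakTopology TruncatedCone] U ∧ IsOpen[weakTopology TruncatedCone] V ∧
      o ∈ U ∧ halfP ∈ V ∧ Disjoint U V := by
  rintro ⟨U, V, hU, hV, hoU, hpV, hUV⟩
  have h1 := weaklyConverges_innerPoint.eventually_mem hV hpV
  -- Diagonal choice: one outer point in V over each inner point in V, with 0 as a dummy index
  -- elsewhere.
  have h2 : ∀ i, ∃ j, innerPoint i ∈ V → outerPoint i j ∈ V := fun i => by
    by_cases hi : innerPoint i ∈ V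
    · obtain ⟨j, hj⟩ := ((weaklyConverges_outerPoint i).eventually_mem hV hi).exists
      exact ⟨j, fun _ => hj⟩
    · exact ⟨0, fun h => absurd h hi⟩
  choose f hf using h2
  obtain ⟨i, hiV, hiU⟩ :=
    (h1.and ((weaklyConverges_outerPoint_o f).eventually_mem hU hoU)).exists
  exact Set.disjoint_left.1 hUV hiU (hf i hiV)

theorem o_ne_halfP : o ≠ halfP := fun h => by
  have h' : treePoint 0 center = treePoint (1 / 2) center := congrArg Subtype.val h
  have := (treePoint_eq_iff.1 h').1
  simp at this

theorem not_t2Space_weakTopology : ¬ @T2Space TruncatedCone (weakTopology TruncatedCone) :=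
  fun h => not_exists_disjoint_weak_nhds (h.t2 o_ne_halfP)

end TruncatedCone

/-! ### Strings along geodesics in Euclidean complexes -/

namespace EuclideanComplex

variable {X : Type*} (C : EuclideanComplex X)

theorem zero_mem_stringLengths (x : X) : 0 ∈ C.stringLengths x x :=
  ⟨0, fun _ => x, fun _ => ∅, rfl, rfl, by simp, by simp⟩

theorem add_mem_stringLengths {x y z : X} {s : Finset C.V} {l : ℝ} (hs : s ∈ C.K.faces)
    (hx : x ∈ C.closedSimplex s) (hy : y ∈ C.closedSimplex s) (hl : l ∈ C.stringLengths y z) :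
    dist (C.position s x) (C.position s y) + l ∈ C.stringLengths x z := by
  obtain ⟨n, u, σ, rfl, rfl, h, rfl⟩ := hl
  refine ⟨n + 1, fun k => k.casesOn x u, fun k => k.casesOn s σ, rfl, rfl, ?_, ?_⟩
  · rintro (_ | i) hi
    · exact ⟨hs, hx, hy⟩
    · exact h i (by omega)
  · rw [Finset.sum_range_succ', add_comm]
    rfl

/-- A geodesic that is covered by finitely many closed simplices can be subdivided into a string
of the same length. -/
theorem sub_mem_stringLengths [MetricSpace X]
    (hdist : ∀ s ∈ C.K.faces, ∀ x ∈ C.closedSimplex s, ∀ y ∈ C.closedSimplex s,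
      dist (C.position s x) (C.position s y) = dist x y)
    {γ : ℝ → X} {b : ℝ} (F : Finset (Finset C.V)) :
    ∀ a ≤ b, (∀ s ∈ F, s ∈ C.K.faces ∧ IsClosed (C.closedSimplex s)) →
      (∀ s ∈ Set.Icc a b, ∀ t ∈ Set.Icc a b, dist (γ s) (γ t) = |s - t|) →
      (∀ s ∈ Set.Icc a b, ∃ σ ∈ F, γ s ∈ C.closedSimplex σ) →
      b - a ∈ C.stringLengths (γ a) (γ b) := by
  classical
  induction F using Finset.strongInduction with
  | H F ih =>
  intro a hab hF hγ hcov
  have hcont : ContinuousOn γ (Set.Icc a b) := by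
    refine LipschitzOnWith.continuousOn (K := 1) (LipschitzOnWith.of_dist_le_mul ?_)
    intro s hs t ht
    rw [hγ s hs t ht]
    simp [Real.dist_eq]
  obtain ⟨σ, hσF, hσ⟩ := hcov a ⟨le_rfl, hab⟩
  have hS : IsCompact (Set.Icc a b ∩ γ ⁻¹' C.closedSimplex σ) :=
    isCompact_Icc.of_isClosed_subset
      (hcont.preimage_isClosed_of_isClosed isClosed_Icc (hF σ hσF).2) Set.inter_subset_left
  -- `c` is the last time in σ. After it the other simplices cover the geodesic; they are closed, so
  -- they also cover time `c`, and the induction runs on the family without σ.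
  obtain ⟨c, ⟨hc, hcσ⟩, hmax⟩ := hS.exists_isGreatest ⟨a, ⟨le_rfl, hab⟩, hσ⟩
  have hstep := hdist σ (hF σ hσF).1 _ hσ _ hcσ
  rw [hγ a ⟨le_rfl, hab⟩ c hc, abs_sub_comm, abs_of_nonneg (by linarith [hc.1])] at hstep
  rcases eq_or_lt_of_le hc.2 with rfl | hlt
  · have := C.add_mem_stringLengths (hF σ hσF).1 hσ hcσ (C.zero_mem_stringLengths _)
    rwa [hstep, add_zero] at this
  · have hsub : Set.Icc c b ⊆ Set.Icc a b := Set.Icc_subset_Icc_left hc.1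
    have hcov' : ∀ s ∈ Set.Icc c b, ∃ τ ∈ F.erase σ, γ s ∈ C.closedSimplex τ := by
      have hclosed : IsClosed (⋃ τ ∈ F.erase σ, C.closedSimplex τ) :=
        (F.erase σ).finite_toSet.isClosed_biUnion fun τ hτ =>
          (hF τ (Finset.mem_of_mem_erase hτ)).2
      have h1 := (hcont.mono hsub).preimage_isClosed_of_isClosed isClosed_Icc hclosed
      have h2 : Set.Ioc c b ⊆ Set.Icc c b ∩ γ ⁻¹' ⋃ τ ∈ F.erase σ, C.closedSimplex τ := by
        intro s hs
        refine ⟨Set.Ioc_subset_Icc_self hs, ?_⟩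
        obtain ⟨τ, hτF, hτ⟩ := hcov s (hsub (Set.Ioc_subset_Icc_self hs))
        refine Set.mem_biUnion (Finset.mem_coe.2 (Finset.mem_erase.2 ⟨?_, hτF⟩)) hτ
        rintro rfl
        exact absurd (hmax ⟨hsub (Set.Ioc_subset_Icc_self hs), hτ⟩) (not_le.2 hs.1)
      have h3 := closure_minimal h2 h1
      rw [closure_Ioc hlt.ne] at h3
      intro s hs
      obtain ⟨τ, hτ, hτs⟩ := Set.mem_iUnion₂.1 (h3 hs).2
      exact ⟨τ, hτ, hτs⟩
    have := C.add_mem_stringLengths (hF σ hσF).1 hσ hcσ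
      (ih _ (Finset.erase_ssubset hσF) c hlt.le
        (fun s hs => hF s (Finset.mem_of_mem_erase hs))
        (fun s hs t ht => hγ s (hsub hs) t (hsub ht)) hcov')
    rw [hstep] at this
    convert this using 1
    ring

end EuclideanComplex

/-! ### The simplicial structure of the truncated cone -/

/-- The vertices of the truncated cone. -/
inductive ConeVertex where
  | o
  | p
  | b (i : ℕ)
  | e (i j : ℕ)

instance : DecidableEq ConeVertex := Classical.decEq _

instance : Countable ConeVertex :=
  Function.Injective.countable (f := fun v : ConeVertex => match v with
    | .o => (Sum.inl true : Bool ⊕ ℕ ⊕ ℕ × ℕ)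
    | .p => Sum.inl false
    | .b i => Sum.inr (Sum.inl i)
    | .e i j => Sum.inr (Sum.inr (i, j))) (by rintro (_ | _ | _ | _) (_ | _ | _ | _) h <;> simp_all)

/-- The vertices of the triangle over an edge. -/
def TreeEdge.simplex : TreeEdge → Finset ConeVertex
  | inner i => {.o, .p, .b i}
  | outer i j => {.o, .b i, .e i j}

theorem TreeEdge.card_simplex (e : TreeEdge) : e.simplex.card = 3 := by
  cases e <;> simp [TreeEdge.simplex]

theorem TreeEdge.sum_simplex (e : TreeEdge) (f : ConeVertex → ℝ) :
    ∑ v ∈ e.simplex, f v = match e with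
      | .inner i => f .o + f .p + f (.b i)
      | .outer i j => f .o + f (.b i) + f (.e i j) := by
  cases e <;> simp [TreeEdge.simplex, add_assoc]

/-- The abstract simplicial complex of the truncated cone. -/
def coneComplex : AbstractSimplicialComplex ConeVertex where
  faces := {s | s.Nonempty ∧ ∃ e : TreeEdge, s ⊆ e.simplex}
  isRelLowerSet_faces := fun _ ⟨h, e, he⟩ => ⟨h, fun _ hb hb' => ⟨hb', e, hb.trans he⟩⟩
  singleton_mem v := by
    refine ⟨Finset.singleton_nonempty v, ?_⟩
    rcases v with _ | _ | i | ⟨i, j⟩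
    · exact ⟨.inner 0, by simp [TreeEdge.simplex]⟩
    · exact ⟨.inner 0, by simp [TreeEdge.simplex]⟩
    · exact ⟨.inner i, by simp [TreeEdge.simplex]⟩
    · exact ⟨.outer i j, by simp [TreeEdge.simplex]⟩

namespace TruncatedCone

open Classical in
/-- The barycentric coordinates of a point of the truncated cone. -/
def bary (x : TruncatedCone) : ConeVertex → ℝ
  | .o => 1 - |abscissa x.1 - ordinate x.1| / 2 - min (abscissa x.1) (ordinate x.1) * √2 / 2
  | .p => max (abscissa x.1 - ordinate x.1) 0 / 2
  | .b i => if x ∈ triangle (.inner i) ∨ ∃ j, x ∈ triangle (.outer i j) then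
      min (abscissa x.1) (ordinate x.1) * √2 / 2 else 0
  | .e i j => if x ∈ triangle (.outer i j) then max (ordinate x.1 - abscissa x.1) 0 / 2 else 0

theorem mem_inner_or_outer {r : ℝ≥0} {c : TreeCoord} (h : ∃ e, treePoint r c ∈ coneTriangle e) :
    treePoint r c ∈ coneTriangle (.inner c.i) ∧
      r * Real.sin c.t ≤ r * Real.cos c.t ∨
    treePoint r c ∈ coneTriangle (.outer c.i c.j) ∧ r * Real.cos c.t ≤ r * Real.sin c.t := by
  rw [exists_mem_coneTriangle_iff, abscissa_treePoint, ordinate_treePoint] at h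
  rcases le_total (r * Real.sin c.t) (r * Real.cos c.t) with h' | h'
  · exact Or.inl ⟨treePoint_mem_inner_iff.2 ⟨h', h.1, Or.inr rfl⟩, h'⟩
  · exact Or.inr ⟨treePoint_mem_outer_iff.2 ⟨h', h.2, Or.inr rfl, Or.inr ⟨rfl, rfl⟩⟩, h'⟩

section

variable {r : ℝ≥0} {c : TreeCoord} (h : ∃ e, treePoint r c ∈ coneTriangle e)

theorem bary_o : bary ⟨treePoint r c, h⟩ .o =
    1 - |r * Real.cos c.t - r * Real.sin c.t| / 2 -
      min (r * Real.cos c.t) (r * Real.sin c.t) * √2 / 2 := by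
  simp only [bary, abscissa_treePoint, ordinate_treePoint]

theorem bary_p : bary ⟨treePoint r c, h⟩ .p = max (r * Real.cos c.t - r * Real.sin c.t) 0 / 2 := by
  simp only [bary, abscissa_treePoint, ordinate_treePoint]

/-- The branch indices are not determined by the point, so the definition tests membership in
triangles. Where membership and index disagree, the point lies on an edge on which the coordinate
vanishes. -/
theorem bary_b (i : ℕ) : bary ⟨treePoint r c, h⟩ (.b i) =
    if c.i = i then min (r * Real.cos c.t) (r * Real.sin c.t) * √2 / 2 else 0 := by
  simp only [bary, abscissa_treePoint, ordinate_treePoint]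
  have h0 : 0 ≤ r * Real.cos c.t := mul_nonneg r.2 c.cos_nonneg
  by_cases hi : c.i = i
  · rw [if_pos hi, if_pos]
    subst hi
    rcases mem_inner_or_outer h with ⟨h', -⟩ | ⟨h', -⟩
    · exact Or.inl h'
    · exact Or.inr ⟨_, h'⟩
  · rw [if_neg hi]
    split_ifs with h'
    · rcases h' with h' | ⟨j, h'⟩
      · obtain ⟨h1, -, h2⟩ := treePoint_mem_inner_iff.1 h'
        rw [min_eq_right h1, h2.resolve_right hi]
        simp
      · obtain ⟨h1, -, h2, -⟩ := treePoint_mem_outer_iff.1 h'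
        rw [min_eq_left h1, h2.resolve_right hi]
        simp
    · rfl

theorem bary_e (i j : ℕ) : bary ⟨treePoint r c, h⟩ (.e i j) =
    if c.i = i ∧ c.j = j then max (r * Real.sin c.t - r * Real.cos c.t) 0 / 2 else 0 := by
  simp only [bary, abscissa_treePoint, ordinate_treePoint]
  by_cases hij : c.i = i ∧ c.j = j
  · rw [if_pos hij]
    obtain ⟨rfl, rfl⟩ := hij
    split_ifs with h'
    · rfl
    · rcases mem_inner_or_outer h with ⟨-, h''⟩ | ⟨h'', -⟩
      · rw [max_eq_right (by linarith)]
        simp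
      · exact absurd h'' h'
  · rw [if_neg hij]
    split_ifs with h'
    · obtain ⟨-, -, -, h2⟩ := treePoint_mem_outer_iff.1 h'
      rw [h2.resolve_right hij]
      simp
    · rfl

end

theorem bary_nonneg (x : TruncatedCone) (v : ConeVertex) : 0 ≤ bary x v := by
  obtain ⟨x, hx⟩ := x
  obtain ⟨r, c, rfl⟩ := exists_eq_treePoint x
  have h1 : 0 ≤ r * Real.cos c.t := mul_nonneg r.2 c.cos_nonneg
  have h2 : 0 ≤ r * Real.sin c.t := mul_nonneg r.2 c.sin_nonneg
  rcases v with _ | _ | i | ⟨i, j⟩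
  · rw [bary_o]
    rw [exists_mem_coneTriangle_iff, abscissa_treePoint, ordinate_treePoint] at hx
    rcases le_total (r * Real.sin c.t) (r * Real.cos c.t) with h | h
    · rw [abs_of_nonneg (by linarith), min_eq_right h]; linarith [hx.1]
    · rw [abs_of_nonpos (by linarith), min_eq_left h]; linarith [hx.2]
  · rw [bary_p]; positivity
  · rw [bary_b]; positivity
  · rw [bary_e]; positivity

/-- Vanishing of the coordinates outside the simplex encodes the side of the diagonal and the
branch; the remaining inequality holds throughout the truncated cone. -/
theorem support_bary_subset_iff (x : TruncatedCone) (e : TreeEdge) :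
    Function.support (bary x) ⊆ (e.simplex : Set ConeVertex) ↔ x ∈ triangle e := by
  obtain ⟨x, hx⟩ := x
  obtain ⟨r, c, rfl⟩ := exists_eq_treePoint x
  rw [Function.support_subset_iff']
  have h2 : 0 < √2 := by positivity
  have hx' := hx
  rw [exists_mem_coneTriangle_iff, abscissa_treePoint, ordinate_treePoint] at hx'
  cases e with
  | inner i =>
    change _ ↔ treePoint r c ∈ coneTriangle (.inner i)
    rw [treePoint_mem_inner_iff]
    constructor
    · intro H
      have he := H (.e c.i c.j) (by simp [TreeEdge.simplex])
      rw [bary_e, if_pos ⟨rfl, rfl⟩] at he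
      have hle : r * Real.sin c.t ≤ r * Real.cos c.t := by
        linarith [le_max_left (r * Real.sin c.t - r * Real.cos c.t) 0]
      refine ⟨hle, hx'.1, ?_⟩
      by_cases hi : c.i = i
      · exact Or.inr hi
      · have hb := H (.b c.i) (by simp [TreeEdge.simplex, hi])
        rw [bary_b, if_pos rfl, min_eq_right hle] at hb
        left
        have : r * Real.sin c.t * √2 = 0 := by linarith
        exact (mul_eq_zero.1 this).resolve_right h2.ne'
    · rintro ⟨hle, -, hi⟩ (_ | _ | i' | ⟨i', j'⟩) hv
      · simp [TreeEdge.simplex] at hv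
      · simp [TreeEdge.simplex] at hv
      · rw [bary_b, min_eq_right hle]
        split_ifs with h
        · have : c.i ≠ i := fun h' => hv (by simp [TreeEdge.simplex, ← h, h'])
          rw [hi.resolve_right this]
          simp
        · rfl
      · rw [bary_e, max_eq_right (by linarith)]
        simp
  | outer i j =>
    change _ ↔ treePoint r c ∈ coneTriangle (.outer i j)
    rw [treePoint_mem_outer_iff]
    constructor
    · intro H
      have hp := H .p (by simp [TreeEdge.simplex])
      rw [bary_p] at hp
      have hle : r * Real.cos c.t ≤ r * Real.sin c.t := by
        linarith [le_max_left (r * Real.cos c.t - r * Real.sin c.t) 0]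
      refine ⟨hle, hx'.2, ?_, ?_⟩
      · by_cases hi : c.i = i
        · exact Or.inr hi
        · have hb := H (.b c.i) (by simp [TreeEdge.simplex, hi])
          rw [bary_b, if_pos rfl, min_eq_left hle] at hb
          left
          have : r * Real.cos c.t * √2 = 0 := by linarith
          exact (mul_eq_zero.1 this).resolve_right h2.ne'
      · by_cases hij : c.i = i ∧ c.j = j
        · exact Or.inr hij
        · have he := H (.e c.i c.j) (by
            simpa only [TreeEdge.simplex, Finset.coe_insert, Finset.coe_singleton,
              Set.mem_insert_iff, Set.mem_singleton_iff, reduceCtorEq, false_or,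
              ConeVertex.e.injEq] using hij)
          rw [bary_e, if_pos ⟨rfl, rfl⟩] at he
          left
          linarith [le_max_left (r * Real.sin c.t - r * Real.cos c.t) 0]
    · rintro ⟨hle, -, hi, hij⟩ (_ | _ | i' | ⟨i', j'⟩) hv
      · simp [TreeEdge.simplex] at hv
      · rw [bary_p, max_eq_right (by linarith)]
        simp
      · rw [bary_b, min_eq_left hle]
        split_ifs with h
        · have : c.i ≠ i := fun h' => hv (by simp [TreeEdge.simplex, ← h, h'])
          rw [hi.resolve_right this]
          simp
        · rfl
      · rw [bary_e]
        split_ifs with h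
        · have : ¬ (c.i = i ∧ c.j = j) := fun h' =>
            hv (by simp [TreeEdge.simplex, ← h.1, ← h.2, h'.1, h'.2])
          rw [hij.resolve_right this]
          simp
        · rfl

/-- The barycentric coordinates with respect to a triangle over an inner edge. -/
theorem exists_of_mem_inner {x : TruncatedCone} {i : ℕ} (hx : x ∈ triangle (.inner i)) :
    ∃ (r : ℝ≥0) (c : TreeCoord), x.1 = treePoint r c ∧ c.i = i ∧ c.j = 0 ∧
      bary x .o = 1 - (r * Real.cos c.t - r * Real.sin c.t) / 2 - r * Real.sin c.t * √2 / 2 ∧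
      bary x .p = (r * Real.cos c.t - r * Real.sin c.t) / 2 ∧
      bary x (.b i) = r * Real.sin c.t * √2 / 2 := by
  obtain ⟨x, hx'⟩ := x
  obtain ⟨r, t, -, rfl⟩ := id hx
  set c : TreeCoord := ⟨i, 0, ⟨t, t.2.1, by linarith [t.2.2, Real.pi_pos]⟩⟩
  have hle : r * Real.sin c.t ≤ r * Real.cos c.t := (treePoint_mem_inner_iff (c := c).1 hx).1
  refine ⟨r, c, rfl, rfl, rfl, ?_, ?_, ?_⟩
  · refine (bary_o (c := c) hx').trans ?_
    rw [abs_of_nonneg (by linarith), min_eq_right hle]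
  · refine (bary_p (c := c) hx').trans ?_
    rw [max_eq_left (by linarith)]
  · refine (bary_b (c := c) hx' i).trans ?_
    rw [if_pos rfl, min_eq_right hle]

/-- The barycentric coordinates with respect to a triangle over an outer edge. -/
theorem exists_of_mem_outer {x : TruncatedCone} {i j : ℕ} (hx : x ∈ triangle (.outer i j)) :
    ∃ (r : ℝ≥0) (c : TreeCoord), x.1 = treePoint r c ∧ c.i = i ∧ c.j = j ∧
      bary x .o = 1 - (r * Real.sin c.t - r * Real.cos c.t) / 2 - r * Real.cos c.t * √2 / 2 ∧
      bary x (.b i) = r * Real.cos c.t * √2 / 2 ∧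
      bary x (.e i j) = (r * Real.sin c.t - r * Real.cos c.t) / 2 := by
  obtain ⟨x, hx'⟩ := x
  obtain ⟨r, t, -, rfl⟩ := id hx
  set c : TreeCoord := ⟨i, j, ⟨Real.pi / 4 + t, by linarith [t.2.1, Real.pi_pos],
    by linarith [t.2.2]⟩⟩
  have hle : r * Real.cos c.t ≤ r * Real.sin c.t := (treePoint_mem_outer_iff (c := c).1 hx).1
  refine ⟨r, c, rfl, rfl, rfl, ?_, ?_, ?_⟩
  · refine (bary_o (c := c) hx').trans ?_
    rw [abs_of_nonpos (by linarith), min_eq_left hle, neg_sub]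
  · refine (bary_b (c := c) hx' i).trans ?_
    rw [if_pos rfl, min_eq_left hle]
  · refine (bary_e (c := c) hx' i j).trans ?_
    rw [if_pos ⟨rfl, rfl⟩, max_eq_left (by linarith)]

theorem sum_bary {x : TruncatedCone} {e : TreeEdge} (hx : x ∈ triangle e) :
    ∑ v ∈ e.simplex, bary x v = 1 := by
  rw [TreeEdge.sum_simplex]
  cases e with
  | inner i =>
    obtain ⟨r, c, -, -, -, h1, h2, h3⟩ := exists_of_mem_inner hx
    simp only [h1, h2, h3]
    ring
  | outer i j =>
    obtain ⟨r, c, -, -, -, h1, h2, h3⟩ := exists_of_mem_outer hx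
    simp only [h1, h2, h3]
    ring

/-! ### The Euclidean metric of the simplices -/

/-- The squared weights of the vertices in the Euclidean metric of the simplices. -/
def vertexWeight : ConeVertex → ℝ
  | .o => 2 * √2
  | _ => 4 - 2 * √2

theorem vertexWeight_pos (v : ConeVertex) : 0 < vertexWeight v := by
  cases v <;> simp only [vertexWeight] <;> linarith [sqrt_two_bounds.1, sqrt_two_bounds.2]

theorem dist_sq_eq_of_same_branch {r s : ℝ≥0} {c d : TreeCoord} (hi : c.i = d.i) (hj : c.j = d.j) :
    dist (treePoint r c) (treePoint s d) ^ 2 =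
      (r * Real.cos c.t - s * Real.cos d.t) ^ 2 + (r * Real.sin c.t - s * Real.sin d.t) ^ 2 := by
  rw [dist_treePoint_sq, dist_eq_abs_of_le_overlap, Real.cos_abs, Real.cos_sub]
  · linear_combination (-(r : ℝ) ^ 2) * Real.sin_sq_add_cos_sq c.t -
      (s : ℝ) ^ 2 * Real.sin_sq_add_cos_sq d.t
  · simp only [overlap, hi, hj, if_true]
    exact (min_le_left _ _).trans c.t_le

/-- Vertices on orthogonal axes at the distances √weight have squared distances equal to sums of
weights. The weights are chosen so that o is at squared distance 4 from the other vertices and these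
at 8 - 4√2 from each other, as in the model triangle. -/
theorem dist_sq_eq_sum {x y : TruncatedCone} {e : TreeEdge} (hx : x ∈ triangle e)
    (hy : y ∈ triangle e) :
    dist x y ^ 2 = ∑ v ∈ e.simplex, vertexWeight v * (bary x v - bary y v) ^ 2 := by
  have hsq : √2 * √2 = 2 := Real.mul_self_sqrt (by norm_num)
  rw [TreeEdge.sum_simplex, Subtype.dist_eq]
  cases e with
  | inner i =>
    obtain ⟨r, c, e1, hi, hj, h1, h2, h3⟩ := exists_of_mem_inner hx
    obtain ⟨r', c', e1', hi', hj', h1', h2', h3'⟩ := exists_of_mem_inner hy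
    rw [e1, e1', dist_sq_eq_of_same_branch (hi.trans hi'.symm) (hj.trans hj'.symm)]
    simp only [h1, h2, h3, h1', h2', h3', vertexWeight]
    linear_combination (-((r * Real.cos c.t - r' * Real.cos c'.t) *
      (r * Real.sin c.t - r' * Real.sin c'.t))) * hsq
  | outer i j =>
    obtain ⟨r, c, e1, hi, hj, h1, h2, h3⟩ := exists_of_mem_outer hx
    obtain ⟨r', c', e1', hi', hj', h1', h2', h3'⟩ := exists_of_mem_outer hy
    rw [e1, e1', dist_sq_eq_of_same_branch (hi.trans hi'.symm) (hj.trans hj'.symm)]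
    simp only [h1, h2, h3, h1', h2', h3', vertexWeight]
    linear_combination (-((r * Real.cos c.t - r' * Real.cos c'.t) *
      (r * Real.sin c.t - r' * Real.sin c'.t))) * hsq

theorem bary_injective : Function.Injective bary := by
  intro x y h
  obtain ⟨e, he⟩ := x.2
  have hy : y ∈ triangle e :=
    (support_bary_subset_iff y e).1 (h ▸ (support_bary_subset_iff x e).2 he)
  have := dist_sq_eq_sum he hy
  simp only [h, sub_self, ne_eq, OfNat.ofNat_ne_zero, not_false_eq_true, zero_pow, mul_zero,
    Finset.sum_const_zero] at this
  exact dist_eq_zero.1 (pow_eq_zero_iff two_ne_zero |>.1 this)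

theorem exists_polar_of_nonneg {x y : ℝ} (hx : 0 ≤ x) (hy : 0 ≤ y) :
    ∃ (r : ℝ≥0) (t : Set.Icc (0 : ℝ) (Real.pi / 2)),
      r * Real.cos t = x ∧ r * Real.sin t = y := by
  set z : ℂ := ⟨x, y⟩
  have h1 : |z.arg| ≤ Real.pi / 2 := Complex.abs_arg_le_pi_div_two_iff.2 hx
  have h2 : 0 ≤ z.arg := Complex.arg_nonneg_iff.2 hy
  exact ⟨⟨‖z‖, norm_nonneg z⟩, ⟨z.arg, h2, (abs_le.1 h1).2⟩, Complex.norm_mul_cos_arg z,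
    Complex.norm_mul_sin_arg z⟩

theorem eq_of_eqOn_simplex {f g : ConeVertex → ℝ} {e : TreeEdge}
    (hf : Function.support f ⊆ (e.simplex : Set ConeVertex))
    (hg : Function.support g ⊆ (e.simplex : Set ConeVertex)) (h : ∀ v ∈ e.simplex, f v = g v) :
    f = g := by
  funext v
  by_cases hv : v ∈ e.simplex
  · exact h v hv
  · rw [Function.support_subset_iff'.1 hf v (by simpa using hv),
      Function.support_subset_iff'.1 hg v (by simpa using hv)]

theorem exists_bary_eq {w : ConeVertex → ℝ} {e : TreeEdge} (h0 : ∀ v, 0 ≤ w v)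
    (hw : Function.support w ⊆ (e.simplex : Set ConeVertex)) (h1 : ∑ v ∈ e.simplex, w v = 1) :
    ∃ x, bary x = w := by
  have h2 : √2 * √2 = 2 := Real.mul_self_sqrt (by norm_num)
  rw [TreeEdge.sum_simplex] at h1
  cases e with
  | inner i =>
    simp only at h1
    have hp := h0 .p
    have hb := h0 (.b i)
    have ho := h0 .o
    -- These are the planar coordinates of the combination of the vertices 0, (2, 0) and (√2, √2)
    -- with weights `w`.
    obtain ⟨r, t, hx, hy⟩ := exists_polar_of_nonneg
      (x := 2 * w .p + √2 * w (.b i)) (y := √2 * w (.b i)) (by positivity) (by positivity)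
    have hm : treePoint r ⟨i, 0, t⟩ ∈ coneTriangle (.inner i) := by
      rw [treePoint_mem_inner_iff]
      simp only [hx, hy]
      exact ⟨by linarith, by linear_combination 2 * ho + 2 * h1 + w (.b i) * h2, by simp⟩
    have hm' : ∃ e, treePoint r ⟨i, 0, t⟩ ∈ coneTriangle e := ⟨_, hm⟩
    have hle : √2 * w (.b i) ≤ 2 * w .p + √2 * w (.b i) := by linarith
    refine ⟨⟨_, hm'⟩, eq_of_eqOn_simplex ((support_bary_subset_iff _ _).2 hm) hw ?_⟩
    intro v hv
    simp only [TreeEdge.simplex, Finset.mem_insert, Finset.mem_singleton] at hv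
    rcases hv with rfl | rfl | rfl
    · rw [bary_o]
      simp only [hx, hy]
      rw [abs_of_nonneg (by linarith), min_eq_right hle]
      linear_combination (-w (.b i) / 2) * h2 - h1
    · rw [bary_p]
      simp only [hx, hy]
      rw [max_eq_left (by linarith)]
      ring
    · rw [bary_b]
      simp only [hx, hy, if_true]
      rw [min_eq_right hle]
      linear_combination (w (.b i) / 2) * h2
  | outer i j =>
    simp only at h1
    have hb := h0 (.b i)
    have he := h0 (.e i j)
    have ho := h0 .o
    obtain ⟨r, t, hx, hy⟩ := exists_polar_of_nonneg
      (x := √2 * w (.b i)) (y := 2 * w (.e i j) + √2 * w (.b i)) (by positivity) (by positivity)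
    have hm : treePoint r ⟨i, j, t⟩ ∈ coneTriangle (.outer i j) := by
      rw [treePoint_mem_outer_iff]
      simp only [hx, hy]
      exact ⟨by linarith, by linear_combination 2 * ho + 2 * h1 + w (.b i) * h2, by simp, by simp⟩
    have hm' : ∃ e, treePoint r ⟨i, j, t⟩ ∈ coneTriangle e := ⟨_, hm⟩
    have hle : √2 * w (.b i) ≤ 2 * w (.e i j) + √2 * w (.b i) := by linarith
    refine ⟨⟨_, hm'⟩, eq_of_eqOn_simplex ((support_bary_subset_iff _ _).2 hm) hw ?_⟩
    intro v hv
    simp only [TreeEdge.simplex, Finset.mem_insert, Finset.mem_singleton] at hv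
    rcases hv with rfl | rfl | rfl
    · rw [bary_o]
      simp only [hx, hy]
      rw [abs_of_nonpos (by linarith), min_eq_left hle]
      linear_combination (-w (.b i) / 2) * h2 - h1
    · rw [bary_b]
      simp only [hx, hy, if_true]
      rw [min_eq_left hle]
      linear_combination (w (.b i) / 2) * h2
    · rw [bary_e]
      simp only [hx, hy, and_self, if_true]
      rw [max_eq_left (by linarith)]
      ring

theorem range_bary : Set.range bary =
    {w | (∀ v, 0 ≤ w v) ∧ ∃ s ∈ coneComplex.faces,
      Function.support w = (s : Set ConeVertex) ∧ ∑ v ∈ s, w v = 1} := by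
  ext w
  constructor
  · rintro ⟨x, rfl⟩
    obtain ⟨e, he⟩ := x.2
    have hsupp := (support_bary_subset_iff x e).2 he
    have hsum := sum_bary (x := x) he
    have hsum' : ∑ v ∈ e.simplex with bary x v ≠ 0, bary x v = 1 := by
      rw [Finset.sum_filter_ne_zero, hsum]
    refine ⟨bary_nonneg x, e.simplex.filter (bary x · ≠ 0), ⟨?_, e, Finset.filter_subset _ _⟩, ?_,
      hsum'⟩
    · exact Finset.nonempty_of_sum_ne_zero (hsum'.trans_ne one_ne_zero)
    · ext v
      simp only [Function.mem_support, Finset.coe_filter, Set.mem_ofPred_eq]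
      exact ⟨fun h => ⟨hsupp h, h⟩, fun h => h.2⟩
  · rintro ⟨h0, s, ⟨-, e, he⟩, hs, h1⟩
    have hw : Function.support w ⊆ (e.simplex : Set ConeVertex) :=
      hs.trans_subset (Finset.coe_subset.2 he)
    refine exists_bary_eq h0 hw ?_
    rw [← h1]
    refine (Finset.sum_subset he fun v _ hv => ?_).symm
    exact Function.notMem_support.1 (by rw [hs]; simpa using hv)

/-! ### The complex and its length metric -/

/-- The vertex `v` of the Euclidean simplex with the vertex set `s`. -/
def vertex (s : Finset ConeVertex) (v : s) : EuclideanSpace ℝ s :=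
  EuclideanSpace.single v √(vertexWeight v)

theorem dist_vertex_sq {s : Finset ConeVertex} {v w : s} (h : v ≠ w) :
    dist (vertex s v) (vertex s w) ^ 2 = vertexWeight v + vertexWeight w := by
  rw [dist_eq_norm, norm_sub_sq_real, vertex, vertex, PiLp.norm_single,
    PiLp.norm_single, EuclideanSpace.inner_single_left, PiLp.single_apply,
    if_neg h, Real.norm_eq_abs, Real.norm_eq_abs, sq_abs, sq_abs,
    Real.sq_sqrt (vertexWeight_pos _).le, Real.sq_sqrt (vertexWeight_pos _).le]
  ring

/-- The truncated cone as a Euclidean complex. -/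
@[reducible] def complex : EuclideanComplex TruncatedCone where
  V := ConeVertex
  K := coneComplex
  bary := bary
  bary_injective := bary_injective
  range_bary := range_bary
  vertex := vertex
  affineIndependent s _ := by
    refine LinearIndependent.affineIndependent ℝ
      (linearIndependent_of_ne_zero_of_inner_eq_zero (𝕜 := ℝ) (fun v => ?_) fun v w hvw => ?_)
    · rw [vertex, Ne, PiLp.single_eq_zero_iff]
      exact (Real.sqrt_pos.2 (vertexWeight_pos _)).ne'
    · change inner ℝ (vertex s v) (vertex s w) = 0
      rw [vertex, vertex, EuclideanSpace.inner_single_left, PiLp.single_apply, if_neg hvw,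
        mul_zero]
  dist_vertex s _ t _ v w hvs hws hvt hwt := by
    by_cases h : v = w
    · subst h
      simp
    · refine (sq_eq_sq₀ dist_nonneg dist_nonneg).1 ?_
      rw [dist_vertex_sq (by simpa using h), dist_vertex_sq (by simpa using h)]

theorem closedSimplex_simplex (e : TreeEdge) : complex.closedSimplex e.simplex = triangle e :=
  Set.ext fun x => support_bary_subset_iff x e

theorem position_apply (s : Finset ConeVertex) (x : TruncatedCone) (v : s) :
    complex.position s x v = bary x v * √(vertexWeight v) := by
  change (∑ w : s, bary x w • vertex s w) v = _
  simp [vertex, Pi.single_apply]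

theorem dist_position {s : Finset ConeVertex} (hs : s ∈ coneComplex.faces) {x y : TruncatedCone}
    (hx : x ∈ complex.closedSimplex s) (hy : y ∈ complex.closedSimplex s) :
    dist (complex.position s x) (complex.position s y) = dist x y := by
  obtain ⟨-, e, he⟩ := hs
  have hx' : x ∈ triangle e :=
    (support_bary_subset_iff x e).1 (Set.Subset.trans hx (Finset.coe_subset.2 he))
  have hy' : y ∈ triangle e :=
    (support_bary_subset_iff y e).1 (Set.Subset.trans hy (Finset.coe_subset.2 he))
  refine (sq_eq_sq₀ dist_nonneg dist_nonneg).1 ?_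
  rw [dist_sq_eq_sum hx' hy', EuclideanSpace.dist_sq_eq]
  have hterm : ∀ v : s, dist (complex.position s x v) (complex.position s y v) ^ 2 =
      vertexWeight v * (bary x v - bary y v) ^ 2 := fun v => by
    rw [position_apply, position_apply, Real.dist_eq, sq_abs, ← sub_mul, mul_pow,
      Real.sq_sqrt (vertexWeight_pos _).le, mul_comm]
  refine (Finset.sum_congr rfl fun v _ => hterm v).trans ?_
  rw [Finset.sum_coe_sort s fun v => vertexWeight v * (bary x v - bary y v) ^ 2]
  refine Finset.sum_subset he fun v _ hv => ?_
  have h1 : bary x v = 0 := Function.support_subset_iff'.1 hx v (by simpa using hv)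
  have h2 : bary y v = 0 := Function.support_subset_iff'.1 hy v (by simpa using hv)
  simp [h1, h2]

theorem simplex_mem_faces (e : TreeEdge) : e.simplex ∈ coneComplex.faces :=
  ⟨Finset.card_pos.1 (by rw [e.card_simplex]; norm_num), e, subset_rfl⟩

theorem inducesMetric_complex : complex.InducesMetric := by
  classical
  rintro ⟨x, hx⟩ ⟨y, hy⟩
  obtain ⟨a, c, rfl⟩ := exists_eq_treePoint x
  obtain ⟨b, d, rfl⟩ := exists_eq_treePoint y
  refine IsLeast.isGLB ⟨?_, ?_⟩
  · have hne : Nonempty TruncatedCone := ⟨o⟩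
    choose! σ hσ hσ' using fun (s : ℝ) (hs : s ∈ Set.Icc (0 : ℝ) 1) =>
      exists_isStewartPoint hx hy hs
    obtain ⟨γ, hγ, h0, h1, hcov⟩ := exists_isGeodesic_of_isStewartPoint hσ
    have := complex.sub_mem_stringLengths (γ := γ)
      (fun s hs x hx y hy => dist_position hs hx hy)
      -- The points of the segment lie over the branches of its ends, so these four triangles cover
      -- it.
      (({.inner c.i, .outer c.i c.j, .inner d.i, .outer d.i d.j} : Set TreeEdge).toFinite.toFinset.image
        TreeEdge.simplex) 0 hγ.1 ?_ hγ.2 ?_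
    · rwa [sub_zero, h0, h1] at this
    · intro s hs
      obtain ⟨e, -, rfl⟩ := Finset.mem_image.1 hs
      refine ⟨simplex_mem_faces e, ?_⟩
      rw [closedSimplex_simplex]
      exact (isCompact_coneTriangle e).isClosed.preimage continuous_subtype_val
    · intro s hs
      obtain ⟨t, ht, hst⟩ := hcov s hs
      obtain ⟨ρ, w, hw, hij⟩ := hσ' t ht
      have key : ∃ e : TreeEdge, (e = .inner c.i ∨ e = .outer c.i c.j ∨ e = .inner d.i ∨
          e = .outer d.i d.j) ∧ γ s ∈ triangle e := by
        have hm := mem_inner_or_outer (hw ▸ (σ t).2)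
        rw [← hw, ← hst] at hm
        rcases hij with ⟨hi, hj⟩ | ⟨hi, hj⟩ <;> rw [hi, hj] at hm <;>
          rcases hm with ⟨hm, -⟩ | ⟨hm, -⟩
        · exact ⟨_, Or.inl rfl, hm⟩
        · exact ⟨_, Or.inr (Or.inl rfl), hm⟩
        · exact ⟨_, Or.inr (Or.inr (Or.inl rfl)), hm⟩
        · exact ⟨_, Or.inr (Or.inr (Or.inr rfl)), hm⟩
      obtain ⟨e, he, hes⟩ := key
      exact ⟨e.simplex, Finset.mem_image.2 ⟨e, by simpa using he, rfl⟩,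
        closedSimplex_simplex e ▸ hes⟩
  · rintro l ⟨n, z, s, h0, hn, hs, rfl⟩
    rw [← h0, ← hn]
    -- No string is shorter than the distance: each step has its length in the cone metric, and the
    -- triangle inequality adds them up.
    refine (dist_le_range_sum_dist z n).trans_eq (Finset.sum_congr rfl fun i hi => ?_)
    obtain ⟨h1, h2, h3⟩ := hs i (Finset.mem_range.1 hi)
    exact (dist_position h1 h2 h3).symm

theorem hasDimension_complex : complex.HasDimension 2 :=
  ⟨fun _ ⟨_, e, he⟩ => (Finset.card_le_card he).trans_eq e.card_simplex,
    TreeEdge.simplex (.inner 0), simplex_mem_faces _, TreeEdge.card_simplex _⟩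

theorem countable_faces_complex : complex.K.faces.Countable :=
  Set.countable_univ.mono (Set.subset_univ (α := Finset ConeVertex) _)

theorem triangles_complex :
    {S | ∃ s ∈ complex.K.faces, s.card = 3 ∧ S = complex.closedSimplex s} =
      Set.range triangle := by
  ext S
  constructor
  · rintro ⟨s, ⟨-, e, he⟩, hs, rfl⟩
    obtain rfl := Finset.eq_of_subset_of_card_le he (by rw [e.card_simplex]; exact hs.ge)
    exact ⟨e, (closedSimplex_simplex e).symm⟩
  · rintro ⟨e, rfl⟩
    exact ⟨e.simplex, simplex_mem_faces e, e.card_simplex, (closedSimplex_simplex e).symm⟩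

end TruncatedCone

end

theorem mainTheorem4 :
    IsCAT0 TruncatedCone ∧
    Bornology.IsBounded (Set.univ : Set TruncatedCone) ∧
    TopologicalSpace.SeparableSpace TruncatedCone ∧
    (∃ C : EuclideanComplex TruncatedCone,
      C.InducesMetric ∧ C.HasDimension 2 ∧ C.K.faces.Countable ∧
      {S | ∃ s ∈ C.K.faces, s.card = 3 ∧ S = C.closedSimplex s} =
        Set.range TruncatedCone.triangle) ∧
    (¬ ∃ U V : Set TruncatedCone,
      IsOpen[weakTopology TruncatedCone] U ∧ IsOpen[weakTopology TruncatedCone] V ∧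
      TruncatedCone.o ∈ U ∧ TruncatedCone.halfP ∈ V ∧ Disjoint U V) ∧
    ¬ @T2Space TruncatedCone (weakTopology TruncatedCone) := by
  exact ⟨TruncatedCone.isCAT0, TruncatedCone.isBounded_univ, TruncatedCone.separableSpace,
    ⟨TruncatedCone.complex, TruncatedCone.inducesMetric_complex, TruncatedCone.hasDimension_complex,
      TruncatedCone.countable_faces_complex, TruncatedCone.triangles_complex⟩,
    TruncatedCone.not_exists_disjoint_weak_nhds, TruncatedCone.not_t2Space_weakTopology⟩
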